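/- Let $N\ge 1$, let $\Omega\subset\mathbb R^N$ be open and bounded, let $0<\alpha<1$, and put $s_p=\alpha-\frac Np$ for $p>N/\alpha$, so that $s_p\in(0,1)$. For $0<s<1\le p<\infty$ let $$[u]_{s,p}^p=\iint_{\mathbb R^N\times\mathbb R^N}\frac{|u(x)-u(y)|^p}{|x-y|^{N+sp}}\,dx\,dy,$$ $$W^{s,p}_0(\Omega)=\{u\in L^p(\mathbb R^N): [u]_{s,p}<\infty,\ u=0 \text{ a.e. in }\mathbb R^N\setminus\Omega\},\qquad \|u\|_{s,p}=(\|u\|_p^p+[u]_{s,p}^p)^{1/p}.$$ For $p=\infty$ let $D^\alpha v(x,y)=\frac{v(x)-v(y)}{|x-y|^\alpha}$ and $$W^{\alpha,\infty}_0(\Omega)=\{v\in L^\infty(\mathbb R^N): D^\alpha v\in L^\infty(\mathbb R^N\times\mathbb R^N),\ v=0\text{ a.e. in }\mathbb R^N\setminus\Omega\},$$ with norm $\max(\|v\|_\infty,\|D^\alpha v\|_\infty)$. For a nonempty closed symmetric set $G$ in a real Banach space, let the genus $\gamma(G)\in\mathbb N\cup\{\infty\}$ be the least $m$ such that there is a continuous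 odd map $G\to\mathbb R^m\setminus\{0\}$ ($\infty$ if there is none). For $k\in\mathbb N$ let $\mathcal G^k_{s,p}$ be the family of nonempty sets $G=-G\subset W^{s,p}_0(\Omega)$ that are closed and bounded in $W^{s,p}_0(\Omega)$, with $\|u\|_p=1$ for all $u\in G$ and $\gamma(G)\ge k$; define $\mathcal G^k_{\alpha,\infty}$ in the same way from $W^{\alpha,\infty}_0(\Omega)$ and $\|\cdot\|_\infty$. Let $$\lambda^s_{k,p}=\inf_{G\in\mathcal G^k_{s,p}}\ \sup_{v\in G}\frac{(1-s)[v]_{s,p}^p}{\|v\|_p^p},\qquad \Lambda^\alpha_{k,\infty}=\inf_{G\in\mathcal G^k_{\alpha,\infty}}\ \sup_{v\in G}\frac{\|D^\alpha v\|_\infty}{\|v\|_\infty}$$ (values in $[0,\infty]$): $\lambda^s_{k,p}$ is the $k$-th variational eigenvalue of the fractional $p$-Laplacian. Then for every $k\in\mathbb N$ $$\lim_{p\to\infty}\bigl(\lambda^{s_p}_{k,p}\bigr)^{1/p}=\Lambda^\alpha_{k,\infty}.$$ Moreover, if $|B_r(x)\setminus\Omega|>0$ for all $x\in\partial\Omega$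 and $r>0$ (for instance, if $\Omega$ is Lipschitz), the same limit holds with $W^{\alpha,\infty}_0(\Omega)$ replaced, in the definition of $\Lambda^\alpha_{k,\infty}$, by the space $C^\alpha_0(\Omega)$ of continuous functions on $\mathbb R^N$ that vanish at every point outside $\Omega$ and satisfy $\|D^\alpha v\|_\infty<\infty$. -/

import Mathlib

open MeasureTheory Filter Topology Set
open scoped ENNReal NNReal

noncomputable section

namespace FracEigen

/-- Euclidean space `ℝ^N`. -/
abbrev Eu (N : ℕ) : Type := EuclideanSpace ℝ (Fin N)

/-- Real measurable functions on `ℝ^N`, identified when they agree almost everywhere. All the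
function spaces below are sets of such classes. -/
abbrev Fn (N : ℕ) : Type := Eu N →ₘ[(volume : Measure (Eu N))] ℝ

/-! ### Topology of a norm, and the genus -/

/-- The topology whose open sets are those containing a `q`-ball around each of their points, for
an extended-valued norm `q` (infinite outside the normed space that it defines; that space then
carries its norm topology). -/
@[reducible]
def normTopology {V : Type*} [AddGroup V] (q : V → ℝ≥0∞) : TopologicalSpace V where
  IsOpen U := ∀ u ∈ U, ∃ ε : ℝ≥0∞, 0 < ε ∧ ∀ v, q (v - u) < ε → v ∈ U
  isOpen_univ := fun _ _ => ⟨1, one_pos, fun _ _ => mem_univ _⟩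
  isOpen_inter := by
    rintro s t hs ht u ⟨hus, hut⟩
    obtain ⟨ε, hε, h⟩ := hs u hus
    obtain ⟨δ, hδ, h'⟩ := ht u hut
    exact ⟨min ε δ, lt_min hε hδ, fun v hv =>
      ⟨h v (hv.trans_le (min_le_left _ _)), h' v (hv.trans_le (min_le_right _ _))⟩⟩
  isOpen_sUnion := by
    rintro S hS u ⟨t, htS, hut⟩
    obtain ⟨ε, hε, h⟩ := hS t htS u hut
    exact ⟨ε, hε, fun v hv => ⟨t, htS, h v hv⟩⟩

/-- The Krasnoselskii genus of `A`: the least `m` for which there is a continuous odd map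
`φ : A → ℝ^m ∖ {0}`, and `∞` if there is none. -/
def genus {V : Type*} [TopologicalSpace V] [Neg V] (A : Set V) : ℕ∞ :=
  ⨅ (m : ℕ) (_ : ∃ φ : V → Eu m, ContinuousOn φ A ∧
    ∀ u ∈ A, φ (-u) = -φ u ∧ φ u ≠ 0), (m : ℕ∞)

/-- The genus minimax class attached to a normed space `X` with norm `nrm`, and to a second norm
`q`: the nonempty symmetric subsets of `X`, closed and bounded in `X`, contained in the `q`-unit
sphere, and of genus at least `k` (closedness and the genus refer to the norm `nrm` of `X`). -/
def minimaxClass {V : Type*} [AddGroup V] (X : Set V) (nrm q : V → ℝ≥0∞) (k : ℕ) : Set (Set V) :=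
  {G | G ⊆ X ∧ G.Nonempty ∧ (∀ u ∈ G, -u ∈ G) ∧ IsClosed[normTopology nrm] G ∧
    (∃ C : ℝ≥0, ∀ u ∈ G, nrm u ≤ C) ∧ (∀ u ∈ G, q u = 1) ∧
    (k : ℕ∞) ≤ @genus V (normTopology nrm) _ G}

/-! ### The fractional Sobolev space and the variational eigenvalues, `p < ∞` -/

/-- `[u]_{s,p}^p = ∬ |u(x) - u(y)|^p / |x - y|^{N + sp} dx dy`. -/
def gagliardoPow {N : ℕ} (s p : ℝ) (u : Eu N → ℝ) : ℝ≥0∞ :=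
  ∫⁻ z : Eu N × Eu N, ENNReal.ofReal (|u z.1 - u z.2| ^ p / ‖z.1 - z.2‖ ^ (N + s * p))
    ∂((volume : Measure (Eu N)).prod volume)

/-- `‖u‖_{s,p} = (‖u‖_p^p + [u]_{s,p}^p)^{1/p}`. -/
def sobolevNorm {N : ℕ} (s p : ℝ) (u : Fn N) : ℝ≥0∞ :=
  (eLpNorm u (ENNReal.ofReal p) volume ^ p + gagliardoPow s p u) ^ (1 / p)

/-- `W^{s,p}_0(Ω)`: the `u ∈ L^p(ℝ^N)` with `[u]_{s,p} < ∞` and `u = 0` a.e. outside `Ω`. -/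
def sobolevZero {N : ℕ} (Ω : Set (Eu N)) (s p : ℝ) : Set (Fn N) :=
  {u | eLpNorm u (ENNReal.ofReal p) volume < ∞ ∧ gagliardoPow s p u < ∞ ∧
    ∀ᵐ x ∂(volume : Measure (Eu N)), x ∉ Ω → u x = 0}

/-- The `k`-th variational eigenvalue `λ^s_{k,p}` of the fractional `p`-Laplacian, the infimum over
the genus class of the supremum of `(1 - s) [v]_{s,p}^p / ‖v‖_p^p`. -/
def eigenvalue {N : ℕ} (Ω : Set (Eu N)) (s p : ℝ) (k : ℕ) : ℝ≥0∞ :=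
  ⨅ G ∈ minimaxClass (sobolevZero Ω s p) (sobolevNorm s p)
      (fun u => eLpNorm u (ENNReal.ofReal p) volume) k,
    ⨆ v ∈ G, ENNReal.ofReal (1 - s) * gagliardoPow s p v /
      eLpNorm v (ENNReal.ofReal p) volume ^ p

/-! ### The case `p = ∞` -/

/-- The Hölder quotient `D^α v(x, y) = (v(x) - v(y)) / |x - y|^α`. -/
def holderQuotient {N : ℕ} (α : ℝ) (v : Eu N → ℝ) (z : Eu N × Eu N) : ℝ :=
  (v z.1 - v z.2) / ‖z.1 - z.2‖ ^ α

/-- `‖D^α v‖_{L^∞(ℝ^N × ℝ^N)}`. -/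
def holderSeminorm {N : ℕ} (α : ℝ) (v : Eu N → ℝ) : ℝ≥0∞ :=
  eLpNorm (holderQuotient α v) ∞ ((volume : Measure (Eu N)).prod volume)

/-- The Hölder norm `max (‖v‖_∞, ‖D^α v‖_∞)`. -/
def holderNorm {N : ℕ} (α : ℝ) (v : Fn N) : ℝ≥0∞ :=
  max (eLpNorm v ∞ volume) (holderSeminorm α v)

/-- `W^{α,∞}_0(Ω)`: the `v ∈ L^∞(ℝ^N)` with `D^α v ∈ L^∞` and `v = 0` a.e. outside `Ω`. -/
def holderZero {N : ℕ} (Ω : Set (Eu N)) (α : ℝ) : Set (Fn N) :=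
  {v | eLpNorm v ∞ volume < ∞ ∧ holderSeminorm α v < ∞ ∧
    ∀ᵐ x ∂(volume : Measure (Eu N)), x ∉ Ω → v x = 0}

/-- `C^α_0(Ω)` for bounded open `Ω`: the `v ∈ C_0(Ω)` (continuous on `ℝ^N` and zero at every point
outside `Ω`) with `‖D^α v‖_∞ < ∞`. -/
def contHolderZero {N : ℕ} (Ω : Set (Eu N)) (α : ℝ) : Set (Fn N) :=
  {v | (∃ g : Eu N → ℝ, Continuous g ∧ (∀ x, x ∉ Ω → g x = 0) ∧ v =ᵐ[volume] g) ∧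
    holderSeminorm α v < ∞}

/-- The minimax value `Λ^α_{k,∞}` of `‖D^α v‖_∞ / ‖v‖_∞` over the genus class in the space `X`
of Hölder functions. -/
def limitEigenvalue {N : ℕ} (X : Set (Fn N)) (α : ℝ) (k : ℕ) : ℝ≥0∞ :=
  ⨅ G ∈ minimaxClass X (holderNorm α) (fun v => eLpNorm v ∞ volume) k,
    ⨆ v ∈ G, holderSeminorm α v / eLpNorm v ∞ volume

end FracEigen

end

namespace FracEigen

/-! For `s = α - N/p` the exponent `N + s p` equals `α p`, so the Gagliardo seminorm is exactly the
`L^p` norm of `D^α u` over `ℝ^N × ℝ^N` (`gagliardoPow_eq`). Both minimax problems then concern the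
quotients `‖D^α u‖ / ‖u‖`, in `L^p` and in `L^∞`. The factor `1 - s = 1 - α + N/p` lies between `1 -
α` and `1` for `p ≥ N/α`, so its `p`-th root is harmless. Each inequality follows from an odd
continuous map that carries a nearly optimal set of one problem into a sublevel set on the unit
sphere of the other. Such a sublevel set is symmetric, closed and bounded, and its genus is at least
that of the set mapped into it (`genus_le_of_continuousOn`), so it is itself a competitor.

Upper bound: the map is `v ↦ v / ‖v‖_p`. Interpolating between a fixed `L^q` and `L^∞` bounds `‖D^α
v‖_p` by nearly `‖D^α v‖_∞`, while a Hölder function with supremum `1` stays close to `1` on a ball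
of fixed radius, so `‖v‖_p` is not much smaller than `1`. Both estimates are uniform in `v`
(`eventually_holderLp_le`).

Lower bound: a function with `‖D^α u‖_p ≤ M` is, for large `p`, close in `L^p` to a Hölder function
with constant slightly above `M` that vanishes off `Ω` (`eventually_exists_isHolder_approx`). Those
Hölder functions are totally bounded in the sup norm, so one finite net serves all large `p`
(`exists_finset_net`). An odd partition of unity around the net and its negatives gives a map `T`
into the span of the net (`oddApprox`) that moves points little in `L^p` and preserves the Hölder
bound. Since `‖T u‖_p ≤ ‖T u‖_∞ |Ω|^{1/p}`, the norm `‖T u‖_∞` is nearly `1` or larger, and `T u /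
‖T u‖_∞` is the required map. -/

/-! ### Extended seminorms and their topologies -/

/-- An extended seminorm on a real vector space. -/
structure IsExtSeminorm {V : Type*} [AddCommGroup V] [Module ℝ V] (q : V → ℝ≥0∞) : Prop where
  add_le : ∀ u v, q (u + v) ≤ q u + q v
  smul : ∀ (c : ℝ) (u : V), q (c • u) = ‖c‖ₑ * q u

namespace IsExtSeminorm

variable {V : Type*} [AddCommGroup V] [Module ℝ V] {q : V → ℝ≥0∞}

theorem zero (h : IsExtSeminorm q) : q 0 = 0 := by
  simpa using h.smul 0 0

theorem neg (h : IsExtSeminorm q) (u : V) : q (-u) = q u := by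
  simpa using h.smul (-1) u

theorem sub_comm (h : IsExtSeminorm q) (u v : V) : q (u - v) = q (v - u) := by
  rw [← h.neg, neg_sub]

theorem sub_le (h : IsExtSeminorm q) (u v : V) : q (u - v) ≤ q u + q v := by
  rw [sub_eq_add_neg, ← h.neg v]
  exact h.add_le _ _

theorem le_add_sub (h : IsExtSeminorm q) (u v : V) : q u ≤ q v + q (u - v) := by
  simpa using h.add_le v (u - v)

theorem sum_le (h : IsExtSeminorm q) {ι : Type*} (s : Finset ι) (f : ι → V) :
    q (∑ i ∈ s, f i) ≤ ∑ i ∈ s, q (f i) := by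
  classical
  induction s using Finset.induction_on with
  | empty => simp [h.zero]
  | insert a s ha ih =>
    rw [Finset.sum_insert ha, Finset.sum_insert ha]
    exact (h.add_le _ _).trans (by gcongr)

theorem sup (h : IsExtSeminorm q) {q' : V → ℝ≥0∞} (h' : IsExtSeminorm q') :
    IsExtSeminorm fun u => max (q u) (q' u) where
  add_le u v := max_le
    ((h.add_le u v).trans (add_le_add (le_max_left _ _) (le_max_left _ _)))
    ((h'.add_le u v).trans (add_le_add (le_max_right _ _) (le_max_right _ _)))
  smul c u := by
    rw [h.smul, h'.smul]
    exact ((monotone_id.const_mul' ‖c‖ₑ).map_max (a := q u) (b := q' u)).symm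

theorem abs_toReal_sub_le (h : IsExtSeminorm q) {u v : V} (hu : q u ≠ ∞) (hv : q v ≠ ∞) :
    |(q u).toReal - (q v).toReal| ≤ (q (u - v)).toReal := by
  have huv : q (u - v) ≠ ∞ := ne_top_of_le_ne_top (ENNReal.add_ne_top.2 ⟨hu, hv⟩) (h.sub_le u v)
  have h1 := ENNReal.toReal_mono (ENNReal.add_ne_top.2 ⟨hv, huv⟩) (h.le_add_sub u v)
  have h2 := ENNReal.toReal_mono (ENNReal.add_ne_top.2 ⟨hu, h.sub_comm u v ▸ huv⟩)
    (h.le_add_sub v u)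
  rw [ENNReal.toReal_add hv huv] at h1
  rw [h.sub_comm v u, ENNReal.toReal_add hu huv] at h2
  rw [abs_le]
  constructor <;> linarith

end IsExtSeminorm

section NormTopology

variable {V W : Type*} [AddCommGroup V] [AddCommGroup W]

theorem normTopology_anti {q q' : V → ℝ≥0∞} (h : ∀ u, q' u ≤ q u) :
    normTopology q ≤ normTopology q' := by
  intro U hU u hu
  obtain ⟨ε, hε, hb⟩ := hU u hu
  exact ⟨ε, hε, fun v hv => hb v ((h _).trans_lt hv)⟩

/-- Immediate from the definition of open sets; no triangle inequality for `q` is involved, so it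
applies to `sobolevNorm` directly. -/
theorem isClosed_normTopology {q : V → ℝ≥0∞} {G : Set V}
    (h : ∀ u, (∀ ε : ℝ≥0∞, 0 < ε → ∃ v ∈ G, q (v - u) < ε) → u ∈ G) :
    IsClosed[normTopology q] G := by
  let := normTopology q
  refine ⟨fun u hu => ?_⟩
  by_contra! hc
  exact hu (h u fun ε hε => by
    obtain ⟨v, hv, hvG⟩ := hc ε hε
    exact ⟨v, not_not.1 hvG, hv⟩)

/-- The topology is defined for arbitrary `q`; it is the triangle inequality that makes `q`-balls
open, hence neighbourhoods of their centres. -/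
theorem IsExtSeminorm.eventually_sub_lt [Module ℝ V] {q : V → ℝ≥0∞} (hq : IsExtSeminorm q) (u : V)
    {ε : ℝ≥0∞} (hε : 0 < ε) : ∀ᶠ v in @nhds V (normTopology q) u, q (v - u) < ε := by
  let := normTopology q
  refine IsOpen.mem_nhds (s := {v | q (v - u) < ε}) (fun v hv => ?_) (by simpa [hq.zero])
  refine ⟨ε - q (v - u), tsub_pos_of_lt hv, fun w hw => ?_⟩
  have : w - u = (w - v) + (v - u) := by abel
  show q (w - u) < ε
  rw [this]
  exact (hq.add_le _ _).trans_lt (lt_tsub_iff_right.1 hw)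

theorem continuousOn_normTopology_of_eventually {X : Type*} [TopologicalSpace X]
    {q : W → ℝ≥0∞} {f : X → W} {A : Set X}
    (h : ∀ u ∈ A, ∀ ε : ℝ≥0∞, 0 < ε → ∀ᶠ v in 𝓝[A] u, q (f v - f u) < ε) :
    @ContinuousOn X W _ (normTopology q) f A := by
  let := normTopology q
  intro u hu
  refine tendsto_nhds.2 fun U hU hfu => ?_
  obtain ⟨ε, hε, hb⟩ := hU _ hfu
  filter_upwards [h u hu ε hε] with v hv using hb _ hv

theorem IsExtSeminorm.eventually_of_continuousOn [Module ℝ W] {X : Type*} [TopologicalSpace X]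
    {q : W → ℝ≥0∞} (hq : IsExtSeminorm q) {f : X → W} {A : Set X}
    (h : @ContinuousOn X W _ (normTopology q) f A) {u : X} (hu : u ∈ A) {ε : ℝ≥0∞} (hε : 0 < ε) :
    ∀ᶠ v in 𝓝[A] u, q (f v - f u) < ε := by
  let := normTopology q
  exact (h u hu).eventually (hq.eventually_sub_lt (f u) hε)

/-- An extended seminorm is continuous where it is finite. -/
theorem IsExtSeminorm.continuousOn_toReal [Module ℝ V] {q : V → ℝ≥0∞} (hq : IsExtSeminorm q) {A : Set V}
    (hA : ∀ u ∈ A, q u ≠ ∞) :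
    @ContinuousOn V ℝ (normTopology q) _ (fun u => (q u).toReal) A := by
  let := normTopology q
  intro u hu
  refine Metric.tendsto_nhds.2 fun ε hε => ?_
  filter_upwards [nhdsWithin_le_nhds (hq.eventually_sub_lt u (ENNReal.ofReal_pos.2 hε)),
    self_mem_nhdsWithin] with v hv hvA
  rw [Real.dist_eq]
  refine (hq.abs_toReal_sub_le (hA v hvA) (hA u hu)).trans_lt ?_
  exact (ENNReal.lt_ofReal_iff_toReal_lt hv.ne_top).1 hv

/-- Finiteness of `q (f u)` is essential: scalar multiplication is discontinuous in the scalar at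
vectors of infinite norm. -/
theorem IsExtSeminorm.continuousOn_smul [Module ℝ W] {X : Type*} [TopologicalSpace X] {q : W → ℝ≥0∞}
    (hq : IsExtSeminorm q) {c : X → ℝ} {f : X → W} {A : Set X} (hc : ContinuousOn c A)
    (hf : @ContinuousOn X W _ (normTopology q) f A) (hfin : ∀ u ∈ A, q (f u) ≠ ∞) :
    @ContinuousOn X W _ (normTopology q) (fun u => c u • f u) A := by
  refine continuousOn_normTopology_of_eventually fun u hu ε hε => ?_
  have key : ∀ v, q (c v • f v - c u • f u) ≤
      ‖c v‖ₑ * q (f v - f u) + ‖c v - c u‖ₑ * q (f u) := fun v => by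
    have : c v • f v - c u • f u = c v • (f v - f u) + (c v - c u) • f u := by
      simp only [smul_sub, sub_smul]; abel
    rw [this, ← hq.smul, ← hq.smul]
    exact hq.add_le _ _
  have h1 : Tendsto (fun v => q (f v - f u)) (𝓝[A] u) (𝓝 0) :=
    ENNReal.tendsto_nhds_zero.2 fun ε hε =>
      (hq.eventually_of_continuousOn hf hu hε).mono fun _ => le_of_lt
  have h2 : Tendsto (fun v => ‖c v‖ₑ) (𝓝[A] u) (𝓝 ‖c u‖ₑ) := (hc u hu).enorm
  have h3 : Tendsto (fun v => ‖c v - c u‖ₑ) (𝓝[A] u) (𝓝 0) := by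
    simpa using ((hc u hu).sub_const (c u)).enorm
  have h4 := (ENNReal.Tendsto.mul h2 (Or.inr (by simp)) h1 (Or.inr (by simp))).add
    (ENNReal.Tendsto.mul_const (b := q (f u)) h3 (Or.inr (hfin u hu)))
  simp only [mul_zero, zero_mul, add_zero] at h4
  filter_upwards [h4.eventually (gt_mem_nhds hε)] with v hv using (key v).trans_lt hv

theorem IsExtSeminorm.continuousOn_sum [Module ℝ W] {X : Type*} [TopologicalSpace X] {q : W → ℝ≥0∞}
    (hq : IsExtSeminorm q) {ι : Type*} (s : Finset ι) {f : ι → X → W} {A : Set X}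
    (hf : ∀ i ∈ s, @ContinuousOn X W _ (normTopology q) (f i) A) :
    @ContinuousOn X W _ (normTopology q) (fun u => ∑ i ∈ s, f i u) A := by
  refine continuousOn_normTopology_of_eventually fun u hu ε hε => ?_
  have h1 : Tendsto (fun v => ∑ i ∈ s, q (f i v - f i u)) (𝓝[A] u) (𝓝 (∑ i ∈ s, 0)) :=
    tendsto_finsetSum s fun i hi => ENNReal.tendsto_nhds_zero.2 fun ε hε =>
      (hq.eventually_of_continuousOn (hf i hi) hu hε).mono fun _ => le_of_lt
  rw [Finset.sum_const_zero] at h1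
  filter_upwards [h1.eventually (gt_mem_nhds hε)] with v hv
  rw [← Finset.sum_sub_distrib]
  exact (hq.sum_le _ _).trans_lt hv

/-- The genus does not decrease under continuous odd maps. -/
theorem genus_le_of_continuousOn {X Y : Type*} [TopologicalSpace X] [TopologicalSpace Y] [Neg X]
    [Neg Y] {f : X → Y} {A : Set X} {B : Set Y} (hf : ContinuousOn f A)
    (hodd : ∀ u ∈ A, f (-u) = -f u) (hAB : MapsTo f A B) : genus A ≤ genus B := by
  refine le_iInf₂ fun m hm => ?_
  obtain ⟨φ, hφ, h⟩ := hm
  refine iInf₂_le m ⟨φ ∘ f, hφ.comp hf hAB, fun u hu => ?_⟩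
  simp only [Function.comp_apply, hodd u hu]
  exact h _ (hAB hu)

end NormTopology

/-! ### Odd finite-dimensional approximation of the identity -/

section Approx

variable {V : Type*} [AddCommGroup V] {ι : Type*} [Fintype ι]

/-- The hat function of height and radius `ε` around `v`, with respect to `q`. -/
noncomputable def hat (q : V → ℝ≥0∞) (ε : ℝ≥0∞) (v u : V) : ℝ := (ε - q (u - v)).toReal

theorem hat_nonneg (q : V → ℝ≥0∞) (ε : ℝ≥0∞) (v u : V) : 0 ≤ hat q ε v u :=
  ENNReal.toReal_nonneg

theorem lt_of_hat_ne_zero {q : V → ℝ≥0∞} {ε : ℝ≥0∞} {v u : V} (h : hat q ε v u ≠ 0) :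
    q (u - v) < ε := by
  by_contra! hc
  exact h (by simp [hat, tsub_eq_zero_of_le hc])

theorem hat_pos {q : V → ℝ≥0∞} {ε : ℝ≥0∞} (hε : ε ≠ ∞) {v u : V} (h : q (u - v) < ε) :
    0 < hat q ε v u :=
  ENNReal.toReal_pos (tsub_pos_of_lt h).ne' (ENNReal.sub_ne_top hε)

theorem IsExtSeminorm.continuous_hat [Module ℝ V] {q : V → ℝ≥0∞} (hq : IsExtSeminorm q) {ε : ℝ≥0∞}
    (hε : ε ≠ ∞) (v : V) : @Continuous V ℝ (normTopology q) _ (hat q ε v) := by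
  let := normTopology q
  refine continuous_iff_continuousAt.2 fun u => Metric.tendsto_nhds.2 fun δ hδ => ?_
  filter_upwards [hq.eventually_sub_lt u (ENNReal.ofReal_pos.2 hδ)] with w hw
  -- The hat is 1-Lipschitz for `q`; pairs at infinite distance, where `toReal` is the default `0`,
  -- must be set aside.
  have key : ∀ a b : V, hat q ε v a ≤ hat q ε v b + (q (b - a)).toReal ∨ q (b - a) = ∞ := by
    intro a b
    by_cases hba : q (b - a) = ∞
    · exact Or.inr hba
    left
    rw [hat, hat, ← ENNReal.toReal_add (ENNReal.sub_ne_top hε) hba]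
    refine ENNReal.toReal_mono (ENNReal.add_ne_top.2 ⟨ENNReal.sub_ne_top hε, hba⟩) ?_
    have : q (b - v) ≤ q (b - a) + q (a - v) := by
      have := hq.add_le (b - a) (a - v)
      rwa [sub_add_sub_cancel] at this
    rw [tsub_le_iff_right]
    calc ε ≤ ε - q (b - v) + q (b - v) := le_tsub_add
      _ ≤ ε - q (b - v) + (q (b - a) + q (a - v)) := by gcongr
      _ = _ := by ring
  have h1 := (key u w).resolve_right hw.ne_top
  have h2 := (key w u).resolve_right (hq.sub_comm w u ▸ hw.ne_top)
  have h3 := (ENNReal.lt_ofReal_iff_toReal_lt hw.ne_top).1 hw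
  rw [hq.sub_comm u w] at h2
  rw [Real.dist_eq, abs_lt]
  constructor <;> linarith

/-- The normalizing factor of `oddApprox`. -/
noncomputable def oddMass (q : V → ℝ≥0∞) (ε : ℝ≥0∞) (v : ι → V) (u : V) : ℝ :=
  ∑ i, (hat q ε (v i) u + hat q ε (v i) (-u))

/-- The coefficients of `oddApprox`. -/
noncomputable def oddCoeff (q : V → ℝ≥0∞) (ε : ℝ≥0∞) (v : ι → V) (i : ι) (u : V) : ℝ :=
  (hat q ε (v i) u - hat q ε (v i) (-u)) / oddMass q ε v u

/-- The odd map into the span of the points `v i` that is defined by a partition of unity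
subordinate to the `ε`-balls around the points `± v i`. -/
noncomputable def oddApprox [Module ℝ V] (q : V → ℝ≥0∞) (ε : ℝ≥0∞) (v : ι → V) (u : V) : V :=
  ∑ i, oddCoeff q ε v i u • v i

theorem oddMass_neg (q : V → ℝ≥0∞) (ε : ℝ≥0∞) (v : ι → V) (u : V) :
    oddMass q ε v (-u) = oddMass q ε v u := by
  simp only [oddMass, neg_neg, add_comm]

theorem oddApprox_neg [Module ℝ V] (q : V → ℝ≥0∞) (ε : ℝ≥0∞) (v : ι → V) (u : V) :
    oddApprox q ε v (-u) = -oddApprox q ε v u := by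
  rw [oddApprox, oddApprox, ← Finset.sum_neg_distrib]
  refine Finset.sum_congr rfl fun i _ => ?_
  rw [oddCoeff, oddCoeff, oddMass_neg, neg_neg, ← neg_smul, ← neg_div, neg_sub]

theorem oddMass_pos {q : V → ℝ≥0∞} {ε : ℝ≥0∞} (hε : ε ≠ ∞) {v : ι → V} {u : V}
    (h : ∃ i, q (u - v i) < ε) : 0 < oddMass q ε v u := by
  obtain ⟨i, hi⟩ := h
  exact Finset.sum_pos' (fun j _ => add_nonneg (hat_nonneg _ _ _ _) (hat_nonneg _ _ _ _))
    ⟨i, Finset.mem_univ _, add_pos_of_pos_of_nonneg (hat_pos hε hi) (hat_nonneg _ _ _ _)⟩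

theorem IsExtSeminorm.continuousOn_oddCoeff [Module ℝ V] {q : V → ℝ≥0∞} (hq : IsExtSeminorm q) {ε : ℝ≥0∞}
    (hε : ε ≠ ∞) {v : ι → V} {A : Set V} (hA : ∀ u ∈ A, ∃ i, q (u - v i) < ε) (i : ι) :
    @ContinuousOn V ℝ (normTopology q) _ (oddCoeff q ε v i) A := by
  let := normTopology q
  have hneg : Continuous (fun u : V => -u) := by
    refine ⟨fun U hU u hu => ?_⟩
    obtain ⟨δ, hδ, hb⟩ := hU _ hu
    refine ⟨δ, hδ, fun w hw => hb _ ?_⟩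
    rwa [← neg_sub', hq.neg]
  have h1 : ∀ j, Continuous (hat q ε (v j)) := fun j => hq.continuous_hat hε _
  have h2 : ∀ j, Continuous fun u => hat q ε (v j) (-u) := fun j => (h1 j).comp hneg
  have h3 : Continuous (oddMass q ε v) :=
    continuous_finsetSum _ fun j _ => (h1 j).add (h2 j)
  exact ((h1 i).sub (h2 i)).continuousOn.div h3.continuousOn fun u hu =>
    (oddMass_pos hε (hA u hu)).ne'

theorem sum_enorm_oddCoeff_le (q : V → ℝ≥0∞) (ε : ℝ≥0∞) (v : ι → V) (u : V) :
    ∑ i, ‖oddCoeff q ε v i u‖ₑ ≤ 1 := by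
  have hS : 0 ≤ oddMass q ε v u :=
    Finset.sum_nonneg fun j _ => add_nonneg (hat_nonneg _ _ _ _) (hat_nonneg _ _ _ _)
  have h : ∀ i, ‖oddCoeff q ε v i u‖ₑ ≤
      ENNReal.ofReal ((hat q ε (v i) u + hat q ε (v i) (-u)) / oddMass q ε v u) := fun i => by
    rw [Real.enorm_eq_ofReal_abs, oddCoeff, abs_div, abs_of_nonneg hS]
    refine ENNReal.ofReal_le_ofReal (div_le_div_of_nonneg_right ?_ hS)
    have h1 := hat_nonneg q ε (v i) u
    have h2 := hat_nonneg q ε (v i) (-u)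
    rw [abs_le]
    constructor <;> linarith
  refine (Finset.sum_le_sum fun i _ => h i).trans ?_
  rw [← ENNReal.ofReal_sum_of_nonneg fun i _ =>
    div_nonneg (add_nonneg (hat_nonneg _ _ _ _) (hat_nonneg _ _ _ _)) hS, ← Finset.sum_div]
  exact ENNReal.ofReal_le_one.2 (div_self_le_one _)

/-- The coefficients have absolute sum at most `1`, so every seminorm bound on the net survives,
also for a seminorm `q'` unrelated to the `q` that defines the partition. This is how the Hölder
bound is kept while approximating in `L^p`. -/
theorem IsExtSeminorm.oddApprox_le [Module ℝ V] {q q' : V → ℝ≥0∞} (hq' : IsExtSeminorm q') (ε : ℝ≥0∞)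
    {v : ι → V} {C : ℝ≥0∞} (hv : ∀ i, q' (v i) ≤ C) (u : V) : q' (oddApprox q ε v u) ≤ C := by
  calc q' (oddApprox q ε v u) ≤ ∑ i, ‖oddCoeff q ε v i u‖ₑ * q' (v i) := by
        refine (hq'.sum_le _ _).trans (Finset.sum_le_sum fun i _ => ?_)
        rw [hq'.smul]
    _ ≤ ∑ i, ‖oddCoeff q ε v i u‖ₑ * C := by gcongr with i; exact hv i
    _ = (∑ i, ‖oddCoeff q ε v i u‖ₑ) * C := by rw [Finset.sum_mul]
    _ ≤ 1 * C := by gcongr; exact sum_enorm_oddCoeff_le q ε v u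
    _ = C := one_mul C

/-- The value at `u` is a convex combination of the points `v i`, weighted by `hat` at `u`, and `-v
i`, weighted by `hat` at `-u`. A weight is nonzero only if its point is within `ε` of `u`. -/
theorem IsExtSeminorm.oddApprox_sub_le [Module ℝ V] {q : V → ℝ≥0∞} (hq : IsExtSeminorm q) {ε : ℝ≥0∞}
    (hε : ε ≠ ∞) {v : ι → V} {u : V} (h : ∃ i, q (u - v i) < ε) :
    q (oddApprox q ε v u - u) ≤ ε := by
  set S := oddMass q ε v u with hS
  have hSpos : 0 < S := oddMass_pos hε h
  have hrep : oddApprox q ε v u - u = ∑ i, ((hat q ε (v i) u / S) • (v i - u) +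
      (hat q ε (v i) (-u) / S) • (-u - v i)) := by
    have hu : u = ∑ i, ((hat q ε (v i) u / S) + (hat q ε (v i) (-u) / S)) • u := by
      rw [← Finset.sum_smul]
      simp only [← add_div]
      rw [← Finset.sum_div]
      rw [show ∑ i, (hat q ε (v i) u + hat q ε (v i) (-u)) = S from rfl, div_self hSpos.ne',
        one_smul]
    rw [← sub_eq_zero, sub_sub, sub_eq_zero, oddApprox]
    conv_rhs => rw [add_comm]
    refine Eq.trans ?_ (congrArg (_ + ·) hu.symm)
    rw [← Finset.sum_add_distrib]
    refine Finset.sum_congr rfl fun i _ => ?_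
    rw [oddCoeff, ← hS, sub_div]
    module
  have hterm : ∀ i, q ((hat q ε (v i) u / S) • (v i - u) +
      (hat q ε (v i) (-u) / S) • (-u - v i)) ≤
      ENNReal.ofReal ((hat q ε (v i) u + hat q ε (v i) (-u)) / S) * ε := fun i => by
    have aux : ∀ a b : V, (hat q ε (v i) a ≠ 0 → q b < ε) →
        q ((hat q ε (v i) a / S) • b) ≤ ENNReal.ofReal (hat q ε (v i) a / S) * ε := by
      intro a b hab
      rw [hq.smul, Real.enorm_eq_ofReal (div_nonneg (hat_nonneg _ _ _ _) hSpos.le)]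
      by_cases h0 : hat q ε (v i) a = 0
      · simp [h0]
      · gcongr
        exact (hab h0).le
    refine (hq.add_le _ _).trans ?_
    rw [add_div, ENNReal.ofReal_add (div_nonneg (hat_nonneg _ _ _ _) hSpos.le)
      (div_nonneg (hat_nonneg _ _ _ _) hSpos.le), add_mul]
    refine add_le_add (aux u _ fun h0 => ?_) (aux (-u) _ fun h0 => lt_of_hat_ne_zero h0)
    rw [hq.sub_comm]
    exact lt_of_hat_ne_zero h0
  rw [hrep]
  refine (hq.sum_le _ _).trans ((Finset.sum_le_sum fun i _ => hterm i).trans ?_)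
  rw [← Finset.sum_mul, ← ENNReal.ofReal_sum_of_nonneg fun i _ =>
    div_nonneg (add_nonneg (hat_nonneg _ _ _ _) (hat_nonneg _ _ _ _)) hSpos.le, ← Finset.sum_div,
    show ∑ i, (hat q ε (v i) u + hat q ε (v i) (-u)) = S from rfl, div_self hSpos.ne']
  simp

end Approx

/-! ### The `L^p` norms of Hölder quotients -/

section Norms

variable {N : ℕ}

/-- `‖D^α v‖_{L^p(ℝ^N × ℝ^N)}`. -/
noncomputable def holderLp (α : ℝ) (p : ℝ≥0∞) (v : Eu N → ℝ) : ℝ≥0∞ :=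
  eLpNorm (holderQuotient α v) p ((volume : Measure (Eu N)).prod volume)

theorem holderQuotient_congr (α : ℝ) {u v : Eu N → ℝ} (h : u =ᵐ[volume] v) :
    holderQuotient α u =ᵐ[(volume : Measure (Eu N)).prod volume] holderQuotient α v := by
  filter_upwards [Measure.quasiMeasurePreserving_fst.ae_eq_comp h,
    Measure.quasiMeasurePreserving_snd.ae_eq_comp h] with z h1 h2
  simp only [Function.comp_apply] at h1 h2
  rw [holderQuotient, holderQuotient, h1, h2]

theorem holderLp_congr (α : ℝ) (p : ℝ≥0∞) {u v : Eu N → ℝ} (h : u =ᵐ[volume] v) :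
    holderLp α p u = holderLp α p v :=
  eLpNorm_congr_ae (holderQuotient_congr α h)

theorem aestronglyMeasurable_holderQuotient (α : ℝ) {u : Eu N → ℝ}
    (hu : AEStronglyMeasurable u volume) :
    AEStronglyMeasurable (holderQuotient α u) ((volume : Measure (Eu N)).prod volume) := by
  have h1 := hu.comp_quasiMeasurePreserving
    (Measure.quasiMeasurePreserving_fst (μ := (volume : Measure (Eu N)))
      (ν := (volume : Measure (Eu N))))
  have h2 := hu.comp_quasiMeasurePreserving
    (Measure.quasiMeasurePreserving_snd (μ := (volume : Measure (Eu N)))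
      (ν := (volume : Measure (Eu N))))
  have h3 : Measurable fun z : Eu N × Eu N => ‖z.1 - z.2‖ ^ α :=
    (measurable_fst.sub (measurable_snd (α := Eu N) (β := Eu N))).norm.pow_const α
  exact ((h1.sub h2).aemeasurable.div h3.aemeasurable).aestronglyMeasurable

theorem isExtSeminorm_eLpNorm {p : ℝ≥0∞} (hp : 1 ≤ p) :
    IsExtSeminorm fun u : Fn N => eLpNorm u p volume where
  add_le u v := by
    rw [eLpNorm_congr_ae (AEEqFun.coeFn_add u v)]
    exact eLpNorm_add_le u.aestronglyMeasurable v.aestronglyMeasurable hp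
  smul c u := by
    rw [eLpNorm_congr_ae (AEEqFun.coeFn_smul c u)]
    exact eLpNorm_const_smul c _ _ _

theorem isExtSeminorm_holderLp (α : ℝ) {p : ℝ≥0∞} (hp : 1 ≤ p) :
    IsExtSeminorm fun u : Fn N => holderLp α p u where
  add_le u v := by
    rw [holderLp_congr α p (AEEqFun.coeFn_add u v)]
    refine le_trans (le_of_eq ?_) (eLpNorm_add_le
      (aestronglyMeasurable_holderQuotient α u.aestronglyMeasurable)
      (aestronglyMeasurable_holderQuotient α v.aestronglyMeasurable) hp)
    rw [holderLp]
    congr 1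
    ext z
    simp only [holderQuotient, Pi.add_apply]
    ring
  smul c u := by
    rw [holderLp_congr α p (AEEqFun.coeFn_smul c u), holderLp, holderLp, ← eLpNorm_const_smul]
    congr 1
    ext z
    simp only [holderQuotient, Pi.smul_apply, smul_eq_mul]
    ring

theorem isExtSeminorm_holderNorm (α : ℝ) : IsExtSeminorm (holderNorm (N := N) α) :=
  (isExtSeminorm_eLpNorm le_top).sup (isExtSeminorm_holderLp α le_top)

theorem holderLp_rpow_eq_lintegral (α : ℝ) {p : ℝ} (hp : 0 < p) (v : Eu N → ℝ) :
    holderLp α (ENNReal.ofReal p) v ^ p =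
      ∫⁻ z, ‖holderQuotient α v z‖ₑ ^ p ∂((volume : Measure (Eu N)).prod volume) := by
  rw [holderLp, eLpNorm_eq_lintegral_rpow_enorm_toReal (ENNReal.ofReal_pos.2 hp).ne'
    ENNReal.ofReal_ne_top, ENNReal.toReal_ofReal hp.le, ← ENNReal.rpow_mul,
    one_div_mul_cancel hp.ne', ENNReal.rpow_one]

/-- With `s = α - N/p` one has `N + s p = α p`, which makes the kernel the `p`-th power of `|x -
y|^α`. -/
theorem gagliardoPow_eq (α : ℝ) {p : ℝ} (hp : 0 < p) (v : Eu N → ℝ) :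
    gagliardoPow (α - N / p) p v = holderLp α (ENNReal.ofReal p) v ^ p := by
  rw [holderLp_rpow_eq_lintegral α hp, gagliardoPow]
  refine lintegral_congr fun z => ?_
  rw [Real.enorm_eq_ofReal_abs, ENNReal.ofReal_rpow_of_nonneg (abs_nonneg _) hp.le, holderQuotient,
    abs_div, Real.div_rpow (abs_nonneg _) (abs_nonneg _),
    abs_of_nonneg (Real.rpow_nonneg (norm_nonneg _) α), ← Real.rpow_mul (norm_nonneg _)]
  congr 3
  field_simp
  ring

theorem eLpNorm_le_sobolevNorm {s p : ℝ} (hp : 0 < p) (u : Fn N) :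
    eLpNorm u (ENNReal.ofReal p) volume ≤ sobolevNorm s p u := by
  rw [sobolevNorm, one_div, ENNReal.le_rpow_inv_iff hp]
  exact le_self_add

theorem holderLp_le_sobolevNorm {α p : ℝ} (hp : 0 < p) (u : Fn N) :
    holderLp α (ENNReal.ofReal p) u ≤ sobolevNorm (α - N / p) p u := by
  rw [sobolevNorm, one_div, ENNReal.le_rpow_inv_iff hp, gagliardoPow_eq α hp]
  exact le_add_self

/-- With the two preceding bounds this sandwiches `sobolevNorm` between quantities that are clearly
seminorms, so its own triangle inequality is never needed. -/
theorem sobolevNorm_le_add {α p : ℝ} (hp : 1 ≤ p) (u : Fn N) :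
    sobolevNorm (α - N / p) p u ≤
      eLpNorm u (ENNReal.ofReal p) volume + holderLp α (ENNReal.ofReal p) u := by
  rw [sobolevNorm, gagliardoPow_eq α (by linarith)]
  exact ENNReal.rpow_add_rpow_le_add _ _ hp

/-! ### Functions vanishing outside `Ω`, and limits -/

/-- `u = 0` a.e. outside `Ω`. -/
def VanishesOff (Ω : Set (Eu N)) (u : Eu N → ℝ) : Prop :=
  ∀ᵐ x ∂(volume : Measure (Eu N)), x ∉ Ω → u x = 0

namespace VanishesOff

variable {Ω : Set (Eu N)}

theorem congr {u v : Eu N → ℝ} (hu : VanishesOff Ω u) (h : v =ᵐ[volume] u) : VanishesOff Ω v := by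
  filter_upwards [hu, h] with x h1 h2 hx
  rw [h2, h1 hx]

theorem neg {u : Fn N} (hu : VanishesOff Ω u) : VanishesOff Ω ((-u : Fn N) : Eu N → ℝ) := by
  filter_upwards [hu, AEEqFun.coeFn_neg u] with x h1 h2 hx
  rw [h2, Pi.neg_apply, h1 hx, neg_zero]

theorem smul {u : Fn N} (hu : VanishesOff Ω u) (c : ℝ) :
    VanishesOff Ω ((c • u : Fn N) : Eu N → ℝ) := by
  filter_upwards [hu, AEEqFun.coeFn_smul c u] with x h1 h2 hx
  rw [h2, Pi.smul_apply, h1 hx, smul_zero]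

theorem add {u v : Fn N} (hu : VanishesOff Ω u) (hv : VanishesOff Ω v) :
    VanishesOff Ω ((u + v : Fn N) : Eu N → ℝ) := by
  filter_upwards [hu, hv, AEEqFun.coeFn_add u v] with x h1 h2 h3 hx
  rw [h3, Pi.add_apply, h1 hx, h2 hx, add_zero]

theorem sub {u v : Fn N} (hu : VanishesOff Ω u) (hv : VanishesOff Ω v) :
    VanishesOff Ω ((u - v : Fn N) : Eu N → ℝ) := by
  rw [sub_eq_add_neg]
  exact hu.add hv.neg

theorem sum {ι : Type*} (s : Finset ι) {f : ι → Fn N} (h : ∀ i ∈ s, VanishesOff Ω (f i)) :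
    VanishesOff Ω ((∑ i ∈ s, f i : Fn N) : Eu N → ℝ) := by
  classical
  induction s using Finset.induction_on with
  | empty =>
    rw [Finset.sum_empty]
    filter_upwards [AEEqFun.coeFn_zero (μ := (volume : Measure (Eu N))) (β := ℝ)] with x hx _
    rw [hx, Pi.zero_apply]
  | insert a s ha ih =>
    rw [Finset.sum_insert ha]
    exact (h a (Finset.mem_insert_self a s)).add
      (ih fun i hi => h i (Finset.mem_insert_of_mem hi))

/-- On `Ωᶜ` the approximants vanish, so there the norm of `u` equals that of `v - u` and is
arbitrarily small. -/
theorem of_forall_close (hΩ : MeasurableSet Ω) {p : ℝ≥0∞} (hp : p ≠ 0) {u : Fn N}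
    (h : ∀ ε : ℝ≥0∞, 0 < ε → ∃ v : Fn N, VanishesOff Ω v ∧
      eLpNorm ((v - u : Fn N) : Eu N → ℝ) p volume < ε) : VanishesOff Ω u := by
  have h0 : eLpNorm u p (volume.restrict Ωᶜ) = 0 := by
    refine le_antisymm (le_of_forall_pos_le_add fun ε hε => ?_) bot_le
    obtain ⟨v, hv, hvu⟩ := h ε hε
    rw [zero_add]
    refine le_trans (le_of_eq ?_)
      ((eLpNorm_mono_measure _ (Measure.restrict_le_self (s := Ωᶜ))).trans hvu.le)
    rw [← eLpNorm_neg]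
    refine eLpNorm_congr_ae ?_
    filter_upwards [ae_restrict_of_ae (AEEqFun.coeFn_sub v u), ae_restrict_of_ae hv,
      ae_restrict_mem hΩ.compl] with x h1 h2 h3
    rw [h1, Pi.sub_apply, h2 h3, zero_sub, Pi.neg_apply]
  rw [eLpNorm_eq_zero_iff u.aestronglyMeasurable.restrict hp] at h0
  exact (ae_restrict_iff' hΩ.compl).1 h0

theorem eLpNorm_eq_restrict (hΩ : MeasurableSet Ω) {u : Eu N → ℝ} (hu : VanishesOff Ω u)
    (p : ℝ≥0∞) : eLpNorm u p volume = eLpNorm u p (volume.restrict Ω) := by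
  rw [← eLpNorm_indicator_eq_eLpNorm_restrict hΩ]
  refine eLpNorm_congr_ae ?_
  filter_upwards [hu] with x hx
  by_cases h : x ∈ Ω <;> simp [h, hx]

theorem eLpNorm_le (hΩ : MeasurableSet Ω) {u : Eu N → ℝ} (hu : VanishesOff Ω u)
    (hm : AEStronglyMeasurable u volume) {p : ℝ} (hp : 0 < p) :
    eLpNorm u (ENNReal.ofReal p) volume ≤ eLpNorm u ∞ volume * volume Ω ^ (1 / p) := by
  rw [hu.eLpNorm_eq_restrict hΩ, hu.eLpNorm_eq_restrict hΩ]
  refine (eLpNorm_le_eLpNorm_mul_rpow_measure_univ le_top hm.restrict).trans ?_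
  rw [ENNReal.toReal_ofReal hp.le, ENNReal.toReal_top, div_zero, sub_zero,
    Measure.restrict_apply_univ]

end VanishesOff

theorem IsExtSeminorm.le_of_forall_close {V : Type*} [AddCommGroup V] [Module ℝ V]
    {q : V → ℝ≥0∞} (hq : IsExtSeminorm q) {u : V} {C : ℝ≥0∞}
    (h : ∀ ε : ℝ≥0∞, 0 < ε → ∃ v, q v ≤ C ∧ q (v - u) < ε) : q u ≤ C := by
  refine le_of_forall_pos_le_add fun ε hε => ?_
  obtain ⟨v, hv, hvu⟩ := h ε hε
  refine (hq.le_add_sub u v).trans (add_le_add hv ?_)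
  rw [hq.sub_comm]
  exact hvu.le

theorem IsExtSeminorm.eq_of_forall_close {V : Type*} [AddCommGroup V] [Module ℝ V]
    {q : V → ℝ≥0∞} (hq : IsExtSeminorm q) {u : V} {C : ℝ≥0∞}
    (h : ∀ ε : ℝ≥0∞, 0 < ε → ∃ v, q v = C ∧ q (v - u) < ε) : q u = C := by
  refine le_antisymm (hq.le_of_forall_close fun ε hε => ?_)
    (le_of_forall_pos_le_add fun ε hε => ?_)
  · obtain ⟨v, hv, hvu⟩ := h ε hε
    exact ⟨v, hv.le, hvu⟩
  · obtain ⟨v, hv, hvu⟩ := h ε hε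
    rw [← hv]
    exact (hq.le_add_sub v u).trans (by gcongr)

/-! ### Comparison of the norms -/

theorem ae_abs_sub_le_of_holderSeminorm_le {α : ℝ} {v : Eu N → ℝ} {M : ℝ} (hM : 0 ≤ M)
    (h : holderSeminorm α v ≤ ENNReal.ofReal M) :
    ∀ᵐ z ∂((volume : Measure (Eu N)).prod volume), |v z.1 - v z.2| ≤ M * ‖z.1 - z.2‖ ^ α := by
  rw [holderSeminorm, eLpNorm_exponent_top] at h
  filter_upwards [ae_le_eLpNormEssSup (f := holderQuotient α v)
    (μ := (volume : Measure (Eu N)).prod volume)] with z hz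
  have hz' := hz.trans h
  rw [Real.enorm_eq_ofReal_abs, ENNReal.ofReal_le_ofReal_iff hM, holderQuotient, abs_div,
    abs_of_nonneg (Real.rpow_nonneg (norm_nonneg _) α)] at hz'
  rcases eq_or_ne z.1 z.2 with he | hne
  · rw [he, sub_self, abs_zero]
    positivity
  · exact (div_le_iff₀ (Real.rpow_pos_of_pos (norm_pos_iff.2 (sub_ne_zero.2 hne)) α)).1 hz'

theorem holderSeminorm_le_of_ae {α : ℝ} {v : Eu N → ℝ} {M : ℝ} (hM : 0 ≤ M)
    (h : ∀ᵐ z ∂((volume : Measure (Eu N)).prod volume), |v z.1 - v z.2| ≤ M * ‖z.1 - z.2‖ ^ α) :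
    holderSeminorm α v ≤ ENNReal.ofReal M := by
  rw [holderSeminorm, eLpNorm_exponent_top]
  refine eLpNormEssSup_le_of_ae_bound ?_
  filter_upwards [h] with z hz
  rw [Real.norm_eq_abs, holderQuotient, abs_div,
    abs_of_nonneg (Real.rpow_nonneg (norm_nonneg _) α)]
  exact div_le_of_le_mul₀ (Real.rpow_nonneg (norm_nonneg _) α) hM hz

/-- For `t ≤ 1` the quotient bound suffices; for `t ≥ 1` the oscillation bound `2 * B` supplies the
decay. In both ranges `(1 + t) ^ α` costs a factor of at most `2`. -/
theorem abs_le_decay {α : ℝ} (hα0 : 0 < α) (hα1 : α < 1) {t a B : ℝ} (ht : 0 ≤ t)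
    (h1 : |a / t ^ α| ≤ B) (h2 : |a| ≤ 2 * B) : |a / t ^ α| ≤ 4 * B * (1 + t) ^ (-α) := by
  have hB : 0 ≤ B := (abs_nonneg _).trans h1
  have h2α : (2 : ℝ) ^ α ≤ 2 := by
    simpa using Real.rpow_le_rpow_of_exponent_le (one_le_two) hα1.le
  rw [Real.rpow_neg (by linarith), ← div_eq_mul_inv, le_div_iff₀ (by positivity)]
  rcases le_total t 1 with h | h
  · have : (1 + t) ^ α ≤ 2 :=
      (Real.rpow_le_rpow (by linarith) (by linarith) hα0.le).trans h2α
    calc |a / t ^ α| * (1 + t) ^ α ≤ B * 2 := by gcongr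
      _ ≤ 4 * B := by linarith
  · have ht0 : 0 < t ^ α := Real.rpow_pos_of_pos (by linarith) α
    have : (1 + t) ^ α ≤ 2 * t ^ α := by
      refine (Real.rpow_le_rpow (by linarith) (by linarith : 1 + t ≤ 2 * t) hα0.le).trans ?_
      rw [Real.mul_rpow zero_le_two ht]
      gcongr
    calc |a / t ^ α| * (1 + t) ^ α ≤ |a / t ^ α| * (2 * t ^ α) := by gcongr
      _ = 2 * |a| := by rw [abs_div, abs_of_pos ht0]; field_simp
      _ ≤ 4 * B := by linarith

/-- `‖D^α v‖_p ≤ C ‖v‖_{α,∞}` for functions vanishing outside a set of finite measure. -/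
theorem exists_holderLp_le_holderNorm {Ω : Set (Eu N)} (hΩ : MeasurableSet Ω)
    (hΩf : volume Ω ≠ ∞) {α : ℝ} (hα0 : 0 < α) (hα1 : α < 1) {p : ℝ} (hp0 : 0 < p)
    (hp : N < α * p) :
    ∃ C : ℝ≥0∞, C ≠ ∞ ∧ ∀ v : Fn N, VanishesOff Ω v → holderNorm α v ≠ ∞ →
      holderLp α (ENNReal.ofReal p) v ≤ C * holderNorm α v := by
  set k : Eu N → ℝ≥0∞ := fun h => ENNReal.ofReal ((1 + ‖h‖) ^ (-(α * p))) with hk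
  have hkm : Measurable k := by fun_prop
  set I : ℝ≥0∞ := ∫⁻ h, k h with hI
  have hIfin : I < ∞ := finite_integral_one_add_norm (by simpa using hp)
  set χ : Eu N → ℝ≥0∞ := Ω.indicator 1 with hχ
  have hχm : Measurable χ := measurable_one.indicator hΩ
  have hχint : ∫⁻ x, χ x = volume Ω := by
    rw [hχ, lintegral_indicator_one hΩ]
  -- The quotient vanishes a.e. unless one of the two points lies in `Ω`, which the weight `χ z.1 +
  -- χ z.2` records. The kernel `k` is integrable because `α p > N`.
  have hint : ∫⁻ z : Eu N × Eu N, (χ z.1 + χ z.2) * k (z.1 - z.2)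
      ∂((volume : Measure (Eu N)).prod volume) = 2 * (volume Ω * I) := by
    simp only [add_mul]
    rw [lintegral_add_left (by fun_prop), lintegral_prod _ (by fun_prop),
      lintegral_prod_symm _ (by fun_prop), two_mul]
    congr 1
    · have : ∀ x, ∫⁻ y, χ x * k (x - y) = χ x * I := fun x => by
        rw [lintegral_const_mul _ (by fun_prop), lintegral_sub_left_eq_self k x]
      simp only [this]
      rw [lintegral_mul_const _ hχm, hχint]
    · have : ∀ y, ∫⁻ x, χ y * k (x - y) = χ y * I := fun y => by
        rw [lintegral_const_mul _ (by fun_prop), lintegral_sub_right_eq_self k y]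
      simp only [this]
      rw [lintegral_mul_const _ hχm, hχint]
  refine ⟨(4 ^ p * (2 * (volume Ω * I))) ^ (1 / p), ?_, fun v hv hfin => ?_⟩
  · refine ENNReal.rpow_ne_top_of_nonneg (by positivity) (ENNReal.mul_ne_top ?_
      (ENNReal.mul_ne_top (by simp) (ENNReal.mul_ne_top hΩf hIfin.ne)))
    exact ENNReal.rpow_ne_top_of_nonneg hp0.le (by simp)
  set B : ℝ := (holderNorm α v).toReal with hB
  have hBe : holderNorm α v = ENNReal.ofReal B := (ENNReal.ofReal_toReal hfin).symm
  have hBsup : ∀ᵐ x ∂(volume : Measure (Eu N)), |v x| ≤ B := by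
    have h1 : eLpNorm v ∞ volume ≤ ENNReal.ofReal B := hBe ▸ le_max_left _ _
    filter_upwards [ae_le_eLpNormEssSup (f := (v : Eu N → ℝ)) (μ := volume)] with x hx
    have := hx.trans h1
    rwa [Real.enorm_eq_ofReal_abs, ENNReal.ofReal_le_ofReal_iff ENNReal.toReal_nonneg] at this
  have hBq : ∀ᵐ z ∂((volume : Measure (Eu N)).prod volume), |holderQuotient α v z| ≤ B := by
    have h1 : holderSeminorm α v ≤ ENNReal.ofReal B := hBe ▸ le_max_right _ _
    filter_upwards [ae_le_eLpNormEssSup (f := holderQuotient α v)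
      (μ := (volume : Measure (Eu N)).prod volume)] with x hx
    have := hx.trans h1
    rwa [Real.enorm_eq_ofReal_abs, ENNReal.ofReal_le_ofReal_iff ENNReal.toReal_nonneg] at this
  rw [← ENNReal.rpow_le_rpow_iff hp0, holderLp_rpow_eq_lintegral α hp0,
    ENNReal.mul_rpow_of_nonneg _ _ hp0.le, ← ENNReal.rpow_mul, one_div_mul_cancel hp0.ne',
    ENNReal.rpow_one, ← hint, mul_right_comm, ← lintegral_const_mul _ (by fun_prop)]
  refine lintegral_mono_ae ?_
  filter_upwards [hBq, Measure.quasiMeasurePreserving_fst.ae hBsup,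
    Measure.quasiMeasurePreserving_snd.ae hBsup, Measure.quasiMeasurePreserving_fst.ae hv,
    Measure.quasiMeasurePreserving_snd.ae hv] with z hz h1 h2 h3 h4
  by_cases hzΩ : z.1 ∈ Ω ∨ z.2 ∈ Ω
  · have hone : (1 : ℝ≥0∞) ≤ χ z.1 + χ z.2 := by
      rcases hzΩ with h | h
      · simp [hχ, h]
      · simp [hχ, h]
    have hdec : |holderQuotient α v z| ≤ 4 * B * (1 + ‖z.1 - z.2‖) ^ (-α) := by
      refine abs_le_decay hα0 hα1 (norm_nonneg _) hz ((abs_sub _ _).trans (by linarith))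
    have hB0 : 0 ≤ B := (abs_nonneg _).trans hz
    calc ‖holderQuotient α v z‖ₑ ^ p
        ≤ ENNReal.ofReal (4 * B * (1 + ‖z.1 - z.2‖) ^ (-α)) ^ p := by
          rw [Real.enorm_eq_ofReal_abs]
          gcongr
      _ = 4 ^ p * holderNorm α v ^ p * k (z.1 - z.2) := by
          rw [ENNReal.ofReal_mul (by positivity), ENNReal.ofReal_mul (by positivity), ← hBe,
            ENNReal.mul_rpow_of_nonneg _ _ hp0.le, ENNReal.mul_rpow_of_nonneg _ _ hp0.le,
            ENNReal.ofReal_rpow_of_nonneg (p := p) (Real.rpow_nonneg (by positivity) (-α)) hp0.le,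
            ← Real.rpow_mul (by positivity), neg_mul]
          simp [hk]
      _ ≤ 4 ^ p * holderNorm α v ^ p * ((χ z.1 + χ z.2) * k (z.1 - z.2)) := by
          gcongr
          exact le_mul_of_one_le_left' hone
  · push Not at hzΩ
    rw [holderQuotient, h3 hzΩ.1, h4 hzΩ.2]
    simp [hp0]

/-- Interpolation between `L^q` and `L^∞` for Hölder quotients. -/
theorem holderLp_rpow_le {α M p q : ℝ} (hq : 0 < q) (hqp : q ≤ p) {v : Eu N → ℝ}
    (h : holderSeminorm α v ≤ ENNReal.ofReal M) :
    holderLp α (ENNReal.ofReal p) v ^ p ≤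
      ENNReal.ofReal M ^ (p - q) * holderLp α (ENNReal.ofReal q) v ^ q := by
  rw [holderLp_rpow_eq_lintegral α (hq.trans_le hqp), holderLp_rpow_eq_lintegral α hq,
    ← lintegral_const_mul' _ _ (ENNReal.rpow_ne_top_of_nonneg (by linarith) ENNReal.ofReal_ne_top)]
  refine lintegral_mono_ae ?_
  filter_upwards [ae_le_eLpNormEssSup (f := holderQuotient α v)
      (μ := (volume : Measure (Eu N)).prod volume)] with z hz
  calc ‖holderQuotient α v z‖ₑ ^ p
      = ‖holderQuotient α v z‖ₑ ^ (p - q) * ‖holderQuotient α v z‖ₑ ^ q := by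
        rw [← ENNReal.rpow_add_of_nonneg _ _ (by linarith) hq.le, sub_add_cancel]
    _ ≤ _ := by
        gcongr ?_ * _
        exact ENNReal.rpow_le_rpow (hz.trans h) (by linarith)

/-- A lower bound for the `L^p` norms of a Hölder function, in terms of its supremum. -/
theorem le_eLpNorm_of_holderSeminorm_le {α M c r p : ℝ} (hα : 0 < α) (hM : 0 ≤ M)
    (hp : 0 < p) (hc0 : 0 ≤ c) (hr : 0 < r) (hcr : c + 2 * (M * r ^ α) < 1) {v : Fn N}
    (hv : eLpNorm v ∞ volume = 1) (h : holderSeminorm α v ≤ ENNReal.ofReal M) :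
    ENNReal.ofReal c * volume (Metric.ball (0 : Eu N) r) ^ (1 / p) ≤
      eLpNorm v (ENNReal.ofReal p) volume := by
  have hMr : 0 ≤ M * r ^ α := by positivity
  have hae := Measure.ae_ae_of_ae_prod (ae_abs_sub_le_of_holderSeminorm_le hM h)
  -- The essential supremum is `1`, so a point `x` can be chosen with `|v x|` above this threshold
  -- and with the Hölder inequality valid for almost every `y`; then `|v| ≥ c` a.e. on `ball x r`.
  have hfreq : ∃ᵐ x ∂(volume : Measure (Eu N)), c + M * r ^ α < |v x| := by
    intro hcon
    have : eLpNorm v ∞ volume ≤ ENNReal.ofReal (c + M * r ^ α) := by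
      rw [eLpNorm_exponent_top]
      refine eLpNormEssSup_le_of_ae_bound ?_
      filter_upwards [hcon] with x hx using not_lt.1 hx
    rw [hv] at this
    exact absurd this (not_le.2 (ENNReal.ofReal_lt_one.2 (by linarith)))
  obtain ⟨x, hx, hxy⟩ := (hfreq.and_eventually hae).exists
  have hball : ∀ᵐ y ∂(volume.restrict (Metric.ball x r)), c ≤ |v y| := by
    filter_upwards [ae_restrict_of_ae hxy, ae_restrict_mem Metric.isOpen_ball.measurableSet]
      with y h1 h2
    have h3 : ‖x - y‖ ^ α ≤ r ^ α := by
      refine Real.rpow_le_rpow (norm_nonneg _) ?_ hα.le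
      rw [← dist_eq_norm, dist_comm]
      exact (Metric.mem_ball.1 h2).le
    have h4 := abs_sub_abs_le_abs_sub (v x) (v y)
    have h5 : M * ‖x - y‖ ^ α ≤ M * r ^ α := by gcongr
    change |v x - v y| ≤ M * ‖x - y‖ ^ α at h1
    linarith
  calc ENNReal.ofReal c * volume (Metric.ball (0 : Eu N) r) ^ (1 / p)
      = eLpNorm (fun _ : Eu N => c) (ENNReal.ofReal p) (volume.restrict (Metric.ball x r)) := by
        rw [eLpNorm_const' _ (ENNReal.ofReal_pos.2 hp).ne' ENNReal.ofReal_ne_top,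
          ENNReal.toReal_ofReal hp.le, Measure.restrict_apply_univ, Real.enorm_eq_ofReal hc0,
          Measure.addHaar_ball_center volume x r]
    _ ≤ eLpNorm v (ENNReal.ofReal p) (volume.restrict (Metric.ball x r)) := by
        refine eLpNorm_mono_ae ?_
        filter_upwards [hball] with y hy
        rwa [Real.norm_of_nonneg hc0]
    _ ≤ _ := eLpNorm_mono_measure _ Measure.restrict_le_self

theorem tendsto_const_rpow_one_div {a : ℝ} (ha : 0 < a) :
    Tendsto (fun p : ℝ => a ^ (1 / p)) atTop (𝓝 1) := by
  have h : Tendsto (fun p : ℝ => 1 / p) atTop (𝓝 0) := by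
    simpa using tendsto_inv_atTop_zero (𝕜 := ℝ)
  simpa using (tendsto_const_nhds (x := a)).rpow h (Or.inl ha.ne')

/-- `‖D^α v‖_p / ‖v‖_p` is, for large `p`, almost bounded by `‖D^α v‖_∞ / ‖v‖_∞`, uniformly. -/
theorem eventually_holderLp_le {Ω : Set (Eu N)} (hΩ : MeasurableSet Ω)
    (hΩf : volume Ω ≠ ∞) {α : ℝ} (hα0 : 0 < α) (hα1 : α < 1) {M M' : ℝ} (hM : 0 < M)
    (hMM' : M < M') :
    ∀ᶠ p : ℝ in atTop, ∀ v : Fn N, VanishesOff Ω v → eLpNorm v ∞ volume = 1 →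
      holderSeminorm α v ≤ ENNReal.ofReal M →
      eLpNorm v (ENNReal.ofReal p) volume ≠ 0 ∧
      holderLp α (ENNReal.ofReal p) v ≤
        ENNReal.ofReal M' * eLpNorm v (ENNReal.ofReal p) volume := by
  -- `c` is a lower bound for `|v|` on a ball; `M / M' < c` leaves room, since the two sides to be
  -- compared tend to `M' * c` and `M`.
  obtain ⟨c, hc1, hc2⟩ := exists_between ((div_lt_one (hM.trans hMM')).2 hMM')
  have hc0 : 0 < c := (div_pos hM (hM.trans hMM')).trans hc1
  have hcM : M < M' * c := by rwa [div_lt_iff₀' (hM.trans hMM')] at hc1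
  obtain ⟨r, hr, hcr⟩ : ∃ r : ℝ, 0 < r ∧ c + 2 * (M * r ^ α) < 1 := by
    -- This radius gives `2 * (M * r ^ α) = (1 - c) / 2`.
    refine ⟨((1 - c) / (4 * M)) ^ (1 / α), Real.rpow_pos_of_pos (by
      apply div_pos <;> linarith) _, ?_⟩
    rw [← Real.rpow_mul (div_nonneg (by linarith) (by linarith)), one_div_mul_cancel hα0.ne',
      Real.rpow_one]
    field_simp
    linarith
  -- Any fixed exponent with `α q > N` would do; here `α q = N + 1`.
  set q : ℝ := (N + 1) / α with hq
  have hq0 : 0 < q := by positivity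
  obtain ⟨C, hC, hCle⟩ := exists_holderLp_le_holderNorm hΩ hΩf hα0 hα1 hq0
    (by rw [hq]; field_simp; linarith)
  set κ : ℝ := (volume (Metric.ball (0 : Eu N) r)).toReal with hκ
  have hκ0 : 0 < κ := ENNReal.toReal_pos (Metric.measure_ball_pos _ _ hr).ne'
    measure_ball_lt_top.ne
  set K : ℝ := C.toReal * max 1 M + 1 with hK
  have hK0 : 0 < K := by positivity
  have hlim : Tendsto (fun p : ℝ => M' * c * κ ^ (1 / p) - M * ((K / M) ^ q) ^ (1 / p)) atTop
      (𝓝 (M' * c * 1 - M * 1)) :=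
    ((tendsto_const_rpow_one_div hκ0).const_mul _).sub
      ((tendsto_const_rpow_one_div (by positivity)).const_mul _)
  filter_upwards [hlim.eventually (lt_mem_nhds (by linarith : (0 : ℝ) < _)), eventually_ge_atTop q]
    with p hp hqp v hv hv1 hvM
  have hp0 : 0 < p := hq0.trans_le hqp
  have hlow := le_eLpNorm_of_holderSeminorm_le hα0 hM.le hp0 hc0.le hr hcr hv1 hvM
  have hκe : volume (Metric.ball (0 : Eu N) r) = ENNReal.ofReal κ :=
    (ENNReal.ofReal_toReal measure_ball_lt_top.ne).symm
  rw [hκe, ENNReal.ofReal_rpow_of_pos hκ0, ← ENNReal.ofReal_mul hc0.le] at hlow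
  refine ⟨(lt_of_lt_of_le (ENNReal.ofReal_pos.2 (by positivity)) hlow).ne', ?_⟩
  have hnorm : holderNorm α v ≤ ENNReal.ofReal (max 1 M) := by
    rw [holderNorm, hv1, ENNReal.ofReal_max, ENNReal.ofReal_one]
    exact max_le_max le_rfl hvM
  have hq' : holderLp α (ENNReal.ofReal q) v ≤ ENNReal.ofReal K := by
    refine (hCle v hv (hnorm.trans_lt ENNReal.ofReal_lt_top).ne).trans ?_
    rw [← ENNReal.ofReal_toReal hC]
    refine (mul_le_mul_right hnorm _).trans ?_
    rw [← ENNReal.ofReal_mul ENNReal.toReal_nonneg]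
    exact ENNReal.ofReal_le_ofReal (by linarith)
  calc holderLp α (ENNReal.ofReal p) v
      ≤ (ENNReal.ofReal M ^ (p - q) * holderLp α (ENNReal.ofReal q) v ^ q) ^ (1 / p) := by
        rw [one_div, ENNReal.le_rpow_inv_iff hp0]
        exact holderLp_rpow_le hq0 hqp hvM
    _ ≤ (ENNReal.ofReal M ^ (p - q) * ENNReal.ofReal K ^ q) ^ (1 / p) := by gcongr
    _ = ENNReal.ofReal (M * ((K / M) ^ q) ^ (1 / p)) := by
        rw [ENNReal.ofReal_rpow_of_pos hM, ENNReal.ofReal_rpow_of_pos hK0,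
          ← ENNReal.ofReal_mul (by positivity), ENNReal.ofReal_rpow_of_pos (by positivity)]
        congr 1
        rw [Real.rpow_sub hM, Real.div_rpow hK0.le hM.le, div_mul_eq_mul_div, mul_div_assoc,
          Real.mul_rpow (by positivity) (by positivity), ← Real.rpow_mul hM.le,
          mul_one_div_cancel hp0.ne', Real.rpow_one]
    _ ≤ ENNReal.ofReal (M' * (c * κ ^ (1 / p))) := by
        refine ENNReal.ofReal_le_ofReal ?_
        rw [← mul_assoc]
        linarith
    _ = ENNReal.ofReal M' * ENNReal.ofReal (c * κ ^ (1 / p)) :=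
        ENNReal.ofReal_mul (hM.trans hMM').le
    _ ≤ _ := by gcongr

end Norms

/-! ### Hölder functions -/

/-- `|g x - g y| ≤ M d(x, y)^α` for all `x`, `y`. -/
def IsHolder {X : Type*} [PseudoMetricSpace X] (α M : ℝ) (g : X → ℝ) : Prop :=
  ∀ x y, |g x - g y| ≤ M * dist x y ^ α

/-- McShane's extension of Hölder functions. -/
theorem exists_isHolder_extension {X : Type*} [PseudoMetricSpace X] {α M : ℝ} (hα0 : 0 < α)
    (hα1 : α ≤ 1) (hM : 0 ≤ M) {S : Set X} {f : X → ℝ}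
    (hf : ∀ x ∈ S, ∀ y ∈ S, |f x - f y| ≤ M * dist x y ^ α) :
    ∃ g, IsHolder α M g ∧ ∀ x ∈ S, g x = f x := by
  rcases S.eq_empty_or_nonempty with rfl | hS
  · refine ⟨0, fun x y => ?_, by simp⟩
    simpa using mul_nonneg hM (Real.rpow_nonneg dist_nonneg α)
  have : Nonempty S := hS.to_subtype
  have htri : ∀ x y z : X, M * dist x z ^ α ≤ M * dist x y ^ α + M * dist y z ^ α := by
    intro x y z
    rw [← mul_add]
    refine mul_le_mul_of_nonneg_left ?_ hM
    exact (Real.rpow_le_rpow dist_nonneg (dist_triangle x y z) hα0.le).trans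
      (Real.rpow_add_le_add_rpow dist_nonneg dist_nonneg hα0.le hα1)
  have hlow : ∀ x : X, ∀ s : S, ∀ t : S, f s - M * dist x s ^ α ≤ f t + M * dist x t ^ α := by
    intro x s t
    have h1 := (abs_le.1 (hf s s.2 t t.2)).2
    have h2 := htri s x t
    rw [dist_comm (s : X) x] at h2
    linarith
  have hbdd : ∀ x : X, BddBelow (range fun t : S => f t + M * dist x t ^ α) := fun x => by
    obtain ⟨s⟩ := this
    exact ⟨f s - M * dist x s ^ α, by rintro _ ⟨t, rfl⟩; exact hlow x s t⟩
  set g : X → ℝ := fun x => ⨅ t : S, (f t + M * dist x t ^ α) with hg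
  have hle : ∀ x y, g x ≤ g y + M * dist x y ^ α := by
    intro x y
    rw [← sub_le_iff_le_add]
    refine le_ciInf fun t => ?_
    have h1 : g x ≤ f t + M * dist x t ^ α := ciInf_le (hbdd x) t
    linarith [htri x y t]
  refine ⟨g, fun x y => ?_, fun x hx => ?_⟩
  · rw [abs_le]
    have h1 := hle x y
    have h2 := hle y x
    rw [dist_comm y x] at h2
    constructor <;> linarith
  · have h0 : M * dist x x ^ α = 0 := by rw [dist_self, Real.zero_rpow hα0.ne', mul_zero]
    refine le_antisymm ?_ (le_ciInf fun t => ?_)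
    · have h1 : g x ≤ f x + M * dist x x ^ α := ciInf_le (hbdd x) ⟨x, hx⟩
      linarith
    · have h1 := hlow x ⟨x, hx⟩ t
      linarith

theorem IsHolder.continuous {X : Type*} [PseudoMetricSpace X] {α M : ℝ} (hα0 : 0 < α)
    {g : X → ℝ} (hg : IsHolder α M g) : Continuous g := by
  refine continuous_iff_continuousAt.2 fun x => ?_
  rw [ContinuousAt, tendsto_iff_dist_tendsto_zero]
  have h : Tendsto (fun y => M * dist y x ^ α) (𝓝 x) (𝓝 (M * dist x x ^ α)) :=
    ((continuous_id.dist continuous_const).rpow_const fun _ => Or.inr hα0.le).const_mul M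
      |>.tendsto x
  rw [dist_self, Real.zero_rpow hα0.ne', mul_zero] at h
  exact squeeze_zero (fun _ => dist_nonneg) (fun y => by rw [Real.dist_eq]; exact hg y x) h

section

variable {N : ℕ}

theorem IsHolder.holderSeminorm_le {α M : ℝ} (hM : 0 ≤ M) {g : Eu N → ℝ} (hg : IsHolder α M g) :
    holderSeminorm α g ≤ ENNReal.ofReal M :=
  holderSeminorm_le_of_ae hM (ae_of_all _ fun z => by rw [← dist_eq_norm]; exact hg z.1 z.2)

/-- A measurable function with a bounded Hölder quotient has a Hölder representative. -/
theorem exists_isHolder_ae_eq {α M : ℝ} (hα0 : 0 < α) (hα1 : α ≤ 1) (hM : 0 ≤ M)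
    {v : Eu N → ℝ} (h : holderSeminorm α v ≤ ENNReal.ofReal M) :
    ∃ g, IsHolder α M g ∧ v =ᵐ[volume] g := by
  have hae := Measure.ae_ae_of_ae_prod (ae_abs_sub_le_of_holderSeminorm_le hM h)
  -- This set has full measure. Two of its points `x`, `y` are compared through a common `w` near
  -- `y`, and letting `w` tend to `y` loses nothing in the constant; McShane's extension from `S` is
  -- then the representative.
  set S : Set (Eu N) := {x | ∀ᵐ y, |v x - v y| ≤ M * ‖x - y‖ ^ α} with hS
  have hvS : ∀ x ∈ S, ∀ y ∈ S, |v x - v y| ≤ M * dist x y ^ α := by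
    intro x hx y hy
    have hδ : ∀ δ > 0, |v x - v y| ≤ M * (dist x y + δ) ^ α + M * δ ^ α := by
      intro δ hδ
      have hfreq : ∃ᶠ w in ae (volume : Measure (Eu N)), w ∈ Metric.ball y δ :=
        frequently_ae_mem_iff.2 (Metric.measure_ball_pos _ _ hδ).ne'
      obtain ⟨w, hw, hxw, hyw⟩ := (hfreq.and_eventually (Eventually.and hx hy)).exists
      have h1 : ‖y - w‖ ≤ δ := by
        rw [← dist_eq_norm, dist_comm]
        exact (Metric.mem_ball.1 hw).le
      have h2 : ‖x - w‖ ≤ dist x y + δ := by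
        rw [← dist_eq_norm] at h1 ⊢
        exact (dist_triangle x y w).trans (by gcongr)
      have h3 : |v x - v y| ≤ |v x - v w| + |v y - v w| := by
        rw [abs_sub_comm (v y)]
        exact abs_sub_le _ _ _
      calc |v x - v y| ≤ M * ‖x - w‖ ^ α + M * ‖y - w‖ ^ α := by linarith
        _ ≤ _ := by gcongr
    have hlim : Tendsto (fun δ : ℝ => M * (dist x y + δ) ^ α + M * δ ^ α) (𝓝[>] 0)
        (𝓝 (M * (dist x y + 0) ^ α + M * 0 ^ α)) := by
      refine tendsto_nhdsWithin_of_tendsto_nhds (Continuous.tendsto ?_ 0)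
      have h1 : Continuous fun δ : ℝ => (dist x y + δ) ^ α :=
        (continuous_const.add continuous_id).rpow_const fun _ => Or.inr hα0.le
      have h2 : Continuous fun δ : ℝ => δ ^ α :=
        continuous_id.rpow_const fun _ => Or.inr hα0.le
      exact (h1.const_mul M).add (h2.const_mul M)
    rw [Real.zero_rpow hα0.ne', mul_zero, add_zero, add_zero] at hlim
    exact ge_of_tendsto hlim (eventually_nhdsWithin_of_forall fun δ hδ' => hδ δ hδ')
  obtain ⟨g, hg, hgS⟩ := exists_isHolder_extension hα0 hα1 hM hvS
  refine ⟨g, hg, ?_⟩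
  filter_upwards [hae] with x hx
  exact (hgS x hx).symm

/-- A uniform bound on `Ω` for Hölder functions that vanish a.e. outside the bounded set `Ω`. -/
theorem exists_abs_le_of_isHolder (hN : 1 ≤ N) {Ω : Set (Eu N)} (hΩb : Bornology.IsBounded Ω)
    {α : ℝ} (hα0 : 0 < α) {M : ℝ} (hM : 0 ≤ M) :
    ∃ C, ∀ g : Eu N → ℝ, IsHolder α M g → VanishesOff Ω g → ∀ x ∈ Ω, |g x| ≤ C := by
  obtain ⟨R, hR0, hR⟩ := hΩb.subset_ball_lt 0 0
  have : Nonempty (Fin N) := ⟨⟨0, hN⟩⟩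
  -- The unit ball around this point misses `Ω`, so it contains a zero of `g`, from which the Hölder
  -- bound propagates. Vectors of large norm exist because `N ≥ 1`.
  obtain ⟨x₀, hx₀⟩ := NormedSpace.exists_lt_norm ℝ (Eu N) (R + 1)
  set x₁ : Eu N := x₀
  refine ⟨M * (R + 1 + ‖x₁‖) ^ α, fun g hg hv x hx => ?_⟩
  have hfreq : ∃ᶠ w in ae (volume : Measure (Eu N)), w ∈ Metric.ball x₁ 1 :=
    frequently_ae_mem_iff.2 (Metric.measure_ball_pos _ _ one_pos).ne'
  obtain ⟨w, hw, hgw⟩ := (hfreq.and_eventually hv).exists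
  have hwx : ‖w - x₁‖ < 1 := by rwa [← dist_eq_norm]
  have hxR : ‖x‖ < R := by simpa using hR hx
  have h0 : g w = 0 := hgw fun hwΩ => by
    have hwR : ‖w‖ < R := by simpa using hR hwΩ
    have := norm_sub_norm_le x₁ w
    rw [norm_sub_rev] at this
    linarith
  have h1 := hg x w
  rw [h0, sub_zero] at h1
  refine h1.trans ?_
  gcongr
  rw [dist_eq_norm]
  have h2 : ‖w‖ ≤ ‖x₁‖ + ‖w - x₁‖ := norm_le_norm_add_norm_sub' _ _
  have h3 := norm_sub_le x w
  linarith

/-- Hölder functions vanishing outside the bounded set `Ω` are totally bounded in the sup norm. -/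
theorem exists_finite_holder_net (hN : 1 ≤ N) {Ω : Set (Eu N)} (hΩb : Bornology.IsBounded Ω)
    {α : ℝ} (hα0 : 0 < α) {M : ℝ} (hM : 0 ≤ M) {ε : ℝ} (hε : 0 < ε) :
    ∃ F : Set (Eu N → ℝ), F.Finite ∧ (∀ f ∈ F, IsHolder α M f ∧ VanishesOff Ω f) ∧
      ∀ g, IsHolder α M g → VanishesOff Ω g → ∃ f ∈ F, ∀ x ∈ Ω, |g x - f x| ≤ ε := by
  obtain ⟨C, hC⟩ := exists_abs_le_of_isHolder hN hΩb hα0 hM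
  set ρ : ℝ := (ε / (4 * (M + 1))) ^ (1 / α) with hρ
  have hρ0 : 0 < ρ := by positivity
  -- Functions are sampled on a finite `ρ`-net of `Ω`, which turns the family into a bounded set in
  -- finite dimension. The error is `ε / 4` for each of the two functions between sample points and
  -- `ε / 2` at the samples.
  have hρα : M * ρ ^ α ≤ ε / 4 := by
    rw [hρ, ← Real.rpow_mul (by positivity), one_div_mul_cancel hα0.ne', Real.rpow_one,
      ← mul_div_assoc, div_le_div_iff₀ (by positivity) (by positivity)]
    nlinarith
  obtain ⟨t, htΩ, htf, ht⟩ := Metric.finite_approx_of_totallyBounded 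
    (hΩb.isCompact_closure.totallyBounded.subset subset_closure) ρ hρ0
  have := htf.fintype
  set K : Set (Eu N → ℝ) := {g | IsHolder α M g ∧ VanishesOff Ω g} with hK
  set Φ : (Eu N → ℝ) → (t → ℝ) := fun g x => g x with hΦ
  have hbd : Bornology.IsBounded (Φ '' K) := by
    refine (Metric.isBounded_closedBall (x := (0 : t → ℝ)) (r := max C 0)).subset ?_
    rintro _ ⟨g, hg, rfl⟩
    rw [mem_closedBall_zero_iff, pi_norm_le_iff_of_nonneg (le_max_right _ _)]
    exact fun x => (hC g hg.1 hg.2 x (htΩ x.2)).trans (le_max_left _ _)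
  obtain ⟨s, hsK, hsf, hs⟩ := Metric.finite_approx_of_totallyBounded 
    (hbd.isCompact_closure.totallyBounded.subset subset_closure) (ε / 2)
    (by positivity)
  have hpre : ∀ y ∈ s, ∃ g ∈ K, Φ g = y := fun y hy => hsK hy
  choose! j hjK hj using hpre
  refine ⟨j '' s, hsf.image j, ?_, fun g hg hv => ?_⟩
  · rintro _ ⟨y, hy, rfl⟩
    exact hjK y hy
  obtain ⟨y, hy, hgy⟩ := mem_iUnion₂.1 (hs (mem_image_of_mem Φ ⟨hg, hv⟩))
  refine ⟨j y, mem_image_of_mem j hy, fun x hx => ?_⟩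
  obtain ⟨w, hw, hxw⟩ := mem_iUnion₂.1 (ht hx)
  have hdist : dist x w ^ α ≤ ρ ^ α :=
    Real.rpow_le_rpow dist_nonneg (Metric.mem_ball.1 hxw).le hα0.le
  have hbound : M * dist x w ^ α ≤ ε / 4 := (by gcongr : M * dist x w ^ α ≤ M * ρ ^ α).trans hρα
  have h1 := (hg x w).trans hbound
  have h2 := ((hjK y hy).1 x w).trans hbound
  have h3 : |g w - j y w| ≤ ε / 2 := by
    have h4 := dist_le_pi_dist (Φ g) y ⟨w, hw⟩
    rw [← hj y hy] at h4 hgy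
    exact h4.trans (Metric.mem_ball.1 hgy).le
  rw [abs_le] at h1 h2 h3 ⊢
  constructor <;> linarith

/-! ### `C^α_0(Ω)` and `W^{α,∞}_0(Ω)` -/

/-- If the Hölder representative were nonzero at a point outside `Ω`, it would be nonzero on a ball
around it. That ball meets `Ωᶜ` in positive measure: by hypothesis at a frontier point, and
trivially at a point outside the closure. -/
theorem contHolderZero_eq_holderZero {Ω : Set (Eu N)} (hΩb : Bornology.IsBounded Ω) {α : ℝ}
    (hα0 : 0 < α) (hα1 : α ≤ 1)
    (hΩ : ∀ x ∈ frontier Ω, ∀ r > 0, 0 < volume (Metric.ball x r \ Ω)) :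
    contHolderZero Ω α = holderZero Ω α := by
  ext v
  constructor
  · rintro ⟨⟨g, hgc, hg0, hvg⟩, hs⟩
    have hv : VanishesOff Ω v := by
      filter_upwards [hvg] with x hx hxΩ
      rw [hx, hg0 x hxΩ]
    refine ⟨?_, hs, hv⟩
    obtain ⟨C, hC⟩ := hΩb.isCompact_closure.exists_bound_of_continuousOn hgc.continuousOn
    refine lt_of_le_of_lt ?_ (ENNReal.ofReal_lt_top (r := max C 0))
    rw [eLpNorm_exponent_top]
    refine eLpNormEssSup_le_of_ae_bound ?_
    filter_upwards [hvg] with x hx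
    rw [hx]
    by_cases hxΩ : x ∈ Ω
    · exact (hC x (subset_closure hxΩ)).trans (le_max_left _ _)
    · rw [hg0 x hxΩ, norm_zero]
      exact le_max_right _ _
  · rintro ⟨-, hs, hv⟩
    refine ⟨?_, hs⟩
    obtain ⟨g, hg, hvg⟩ := exists_isHolder_ae_eq hα0 hα1 ENNReal.toReal_nonneg
      (ENNReal.ofReal_toReal hs.ne).ge
    have hgc := hg.continuous hα0
    have hg0 : VanishesOff Ω g := VanishesOff.congr hv hvg.symm
    refine ⟨g, hgc, fun x hx => ?_, hvg⟩
    by_contra hgx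
    obtain ⟨r, hr, hball⟩ := Metric.isOpen_iff.1 (isOpen_ne_fun hgc continuous_const) x hgx
    have hpos : 0 < volume (Metric.ball x r \ Ω) := by
      by_cases hxc : x ∈ closure Ω
      · exact hΩ x ⟨hxc, fun h => hx (interior_subset h)⟩ r hr
      · refine lt_of_lt_of_le ?_ (measure_mono (sdiff_subset_sdiff_right subset_closure))
        exact (Metric.isOpen_ball.sdiff isClosed_closure).measure_pos _
          ⟨x, Metric.mem_ball_self hr, hxc⟩
    obtain ⟨w, ⟨hwb, hwΩ⟩, hw⟩ :=
      ((frequently_ae_mem_iff.2 hpos.ne').and_eventually hg0).exists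
    exact hball hwb (hw hwΩ)

end

/-! ### Averages -/

/-- Jensen's inequality for the difference of two averages. -/
theorem enorm_integral_sub_integral_rpow_le {X : Type*} [MeasurableSpace X] {ν₁ ν₂ : Measure X}
    [IsProbabilityMeasure ν₁] [IsProbabilityMeasure ν₂] {u : X → ℝ} (h1 : Integrable u ν₁)
    (h2 : Integrable u ν₂) {p : ℝ} (hp : 1 ≤ p) :
    ‖∫ x, u x ∂ν₁ - ∫ x, u x ∂ν₂‖ₑ ^ p ≤ ∫⁻ z, ‖u z.1 - u z.2‖ₑ ^ p ∂(ν₁.prod ν₂) := by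
  have hp0 : 0 < p := by linarith
  have hi : Integrable (fun z : X × X => u z.1 - u z.2) (ν₁.prod ν₂) :=
    (h1.comp_fst ν₂).sub (h2.comp_snd ν₁)
  have heq : ∫ x, u x ∂ν₁ - ∫ x, u x ∂ν₂ = ∫ z : X × X, (u z.1 - u z.2) ∂(ν₁.prod ν₂) := by
    rw [integral_sub (h1.comp_fst ν₂) (h2.comp_snd ν₁), integral_fun_fst, integral_fun_snd]
    simp
  rw [heq]
  have h3 : ‖∫ z : X × X, (u z.1 - u z.2) ∂(ν₁.prod ν₂)‖ₑ ≤
      eLpNorm (fun z : X × X => u z.1 - u z.2) (ENNReal.ofReal p) (ν₁.prod ν₂) := by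
    refine (enorm_integral_le_lintegral_enorm _).trans ?_
    rw [← eLpNorm_one_eq_lintegral_enorm]
    exact eLpNorm_le_eLpNorm_of_exponent_le (by simpa using hp) hi.aestronglyMeasurable
  refine (ENNReal.rpow_le_rpow h3 hp0.le).trans (le_of_eq ?_)
  rw [eLpNorm_eq_lintegral_rpow_enorm_toReal (ENNReal.ofReal_pos.2 hp0).ne'
    ENNReal.ofReal_ne_top, ENNReal.toReal_ofReal hp0.le, ← ENNReal.rpow_mul,
    one_div_mul_cancel hp0.ne', ENNReal.rpow_one]

section

variable {N : ℕ}

theorem enorm_sub_rpow_le {α p d : ℝ} (hα : 0 ≤ α) (hp : 0 ≤ p) (u : Eu N → ℝ) {x y : Eu N}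
    (h : dist x y ≤ d) :
    ‖u x - u y‖ₑ ^ p ≤ ENNReal.ofReal (d ^ α) ^ p * ‖holderQuotient α u (x, y)‖ₑ ^ p := by
  rw [← ENNReal.mul_rpow_of_nonneg _ _ hp]
  refine ENNReal.rpow_le_rpow ?_ hp
  have hd : 0 ≤ d := dist_nonneg.trans h
  rw [Real.enorm_eq_ofReal_abs, Real.enorm_eq_ofReal_abs, ← ENNReal.ofReal_mul (by positivity)]
  refine ENNReal.ofReal_le_ofReal ?_
  rcases eq_or_ne x y with rfl | hne
  · rw [sub_self, abs_zero]
    positivity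
  have hpos : 0 < ‖x - y‖ ^ α := Real.rpow_pos_of_pos (norm_pos_iff.2 (sub_ne_zero.2 hne)) α
  rw [holderQuotient, abs_div, abs_of_pos hpos, mul_div_left_comm]
  refine le_mul_of_one_le_right (abs_nonneg _) ((one_le_div hpos).2 ?_)
  rw [← dist_eq_norm]
  exact Real.rpow_le_rpow dist_nonneg h hα

theorem integrable_cond_of_eLpNorm_lt_top {u : Eu N → ℝ} (hu : AEStronglyMeasurable u volume)
    {p : ℝ} (hp : 1 ≤ p) (h : eLpNorm u (ENNReal.ofReal p) volume < ∞) {E : Set (Eu N)}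
    (hE0 : volume E ≠ 0) (hE : volume E ≠ ∞) :
    Integrable u (ProbabilityTheory.cond volume E) := by
  have : IsFiniteMeasure (volume.restrict E) := ⟨by simpa using hE.lt_top⟩
  have h1 : MemLp u (ENNReal.ofReal p) (volume.restrict E) := MemLp.restrict E ⟨hu, h⟩
  exact (h1.integrable (by simpa using hp)).smul_measure (ENNReal.inv_ne_top.2 hE0)

/-- The distance of a point value to an average. -/
theorem enorm_sub_average_rpow_le {α p d : ℝ} (hα : 0 ≤ α) (hp : 1 ≤ p) (u : Fn N)
    (hu : eLpNorm u (ENNReal.ofReal p) volume < ∞) {κ : ℝ≥0∞} {E : Set (Eu N)}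
    (hE : MeasurableSet E) (hκ0 : κ ≠ 0) (hEκ : κ ≤ volume E) (hEf : volume E ≠ ∞) {x : Eu N}
    (hd : ∀ y ∈ E, dist x y ≤ d) :
    ‖u x - ∫ y, u y ∂(ProbabilityTheory.cond volume E)‖ₑ ^ p ≤
      κ⁻¹ * ENNReal.ofReal (d ^ α) ^ p * ∫⁻ y, ‖holderQuotient α u (x, y)‖ₑ ^ p := by
  have hE0 : volume E ≠ 0 := (hκ0.bot_lt.trans_le hEκ).ne'
  have := ProbabilityTheory.cond_isProbabilityMeasure_of_finite hE0 hEf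
  have hm : Measurable (u : Eu N → ℝ) := u.stronglyMeasurable.measurable
  have hint := integrable_cond_of_eLpNorm_lt_top u.aestronglyMeasurable hp hu hE0 hEf
  -- The point value is the average against a Dirac mass.
  have hmain := enorm_integral_sub_integral_rpow_le (u := u)
    (integrable_dirac (a := x) (by finiteness)) hint hp
  rw [integral_dirac, Measure.dirac_prod, lintegral_map (by fun_prop) measurable_prodMk_left]
    at hmain
  refine hmain.trans ?_
  simp only [ProbabilityTheory.cond, lintegral_smul_measure, smul_eq_mul]
  rw [mul_assoc]
  refine mul_le_mul' (ENNReal.inv_le_inv.2 hEκ) ?_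
  rw [← lintegral_const_mul' _ _ (by finiteness)]
  exact (setLIntegral_mono' hE fun y hy => enorm_sub_rpow_le hα (by linarith) u (hd y hy)).trans
    (setLIntegral_le_lintegral _ _)

/-- The distance of two averages. -/
theorem enorm_average_sub_average_rpow_le {α p d : ℝ} (hα : 0 ≤ α) (hp : 1 ≤ p) (u : Fn N)
    (hu : eLpNorm u (ENNReal.ofReal p) volume < ∞) {κ : ℝ≥0∞} {E E' : Set (Eu N)}
    (hE : MeasurableSet E) (hE' : MeasurableSet E') (hκ0 : κ ≠ 0) (hEκ : κ ≤ volume E)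
    (hEκ' : κ ≤ volume E') (hEf : volume E ≠ ∞) (hEf' : volume E' ≠ ∞)
    (hd : ∀ x ∈ E, ∀ y ∈ E', dist x y ≤ d) :
    ‖∫ y, u y ∂(ProbabilityTheory.cond volume E) - ∫ y, u y ∂(ProbabilityTheory.cond volume E')‖ₑ
      ^ p ≤ κ⁻¹ * κ⁻¹ * ENNReal.ofReal (d ^ α) ^ p * holderLp α (ENNReal.ofReal p) u ^ p := by
  have hE0 : volume E ≠ 0 := (hκ0.bot_lt.trans_le hEκ).ne'
  have hE0' : volume E' ≠ 0 := (hκ0.bot_lt.trans_le hEκ').ne'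
  have := ProbabilityTheory.cond_isProbabilityMeasure_of_finite hE0 hEf
  have := ProbabilityTheory.cond_isProbabilityMeasure_of_finite hE0' hEf'
  have hmain := enorm_integral_sub_integral_rpow_le (u := u)
    (integrable_cond_of_eLpNorm_lt_top u.aestronglyMeasurable hp hu hE0 hEf)
    (integrable_cond_of_eLpNorm_lt_top u.aestronglyMeasurable hp hu hE0' hEf') hp
  refine hmain.trans ?_
  rw [ProbabilityTheory.cond, ProbabilityTheory.cond, Measure.prod_smul_left,
    Measure.prod_smul_right, Measure.prod_restrict, lintegral_smul_measure, lintegral_smul_measure,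
    smul_eq_mul, smul_eq_mul, holderLp_rpow_eq_lintegral α (by linarith), mul_assoc, mul_assoc]
  refine mul_le_mul' (ENNReal.inv_le_inv.2 hEκ) (mul_le_mul' (ENNReal.inv_le_inv.2 hEκ') ?_)
  rw [← lintegral_const_mul' _ _ (by finiteness)]
  exact (setLIntegral_mono' (hE.prod hE') fun z hz =>
    enorm_sub_rpow_le hα (by linarith) u (hd z.1 hz.1 z.2 hz.2)).trans
    (setLIntegral_le_lintegral _ _)

/-! ### Approximation of Sobolev functions by Hölder functions -/

/-- A maximal `ρ`-separated extension of a set. -/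
theorem exists_separated_superset {X : Type*} [PseudoMetricSpace X] (Z : Set X) {ρ : ℝ} :
    ∃ S, Z ⊆ S ∧ (∀ s ∈ S, ∀ t ∈ S, s ≠ t → (s ∈ Z ∧ t ∈ Z) ∨ ρ ≤ dist s t) ∧
      (0 < ρ → ∀ x, ∃ s ∈ S, dist x s < ρ) := by
  obtain ⟨S, hZS, hS⟩ := zorn_subset_nonempty
    {S : Set X | ∀ s ∈ S, ∀ t ∈ S, s ≠ t → (s ∈ Z ∧ t ∈ Z) ∨ ρ ≤ dist s t} (fun c hc hchain _ => by
      refine ⟨⋃₀ c, ?_, fun s hs => subset_sUnion_of_mem hs⟩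
      rintro s ⟨A, hA, hsA⟩ t ⟨B, hB, htB⟩ hst
      rcases hchain.total hA hB with h | h
      · exact hc hB s (h hsA) t htB hst
      · exact hc hA s hsA t (h htB) hst) Z (fun s hs t ht _ => Or.inl ⟨hs, ht⟩)
  refine ⟨S, hZS, hS.prop, fun hρ x => ?_⟩
  by_contra! hx
  have hxS : x ∈ S := by
    refine hS.le_of_ge (y := insert x S) ?_ (subset_insert x S) (mem_insert x S)
    rintro s (rfl | hs) t (rfl | ht) hst
    · exact absurd rfl hst
    · exact Or.inr (hx t ht)
    · rw [dist_comm]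
      exact Or.inr (hx s hs)
    · exact hS.prop s hs t ht hst
  have := hx x hxS
  rw [dist_self] at this
  linarith

/-- Balls around the points of the support of `volume` on `Ωᶜ` meet `Ωᶜ` in sets whose measure is
bounded below. -/
theorem exists_le_volume_ball_diff {Ω : Set (Eu N)}
    (hΩb : Bornology.IsBounded Ω) {r : ℝ} (hr : 0 < r) :
    ∃ κ : ℝ≥0∞, κ ≠ 0 ∧ κ ≤ volume (Metric.ball (0 : Eu N) r) ∧
      ∀ z ∈ ((volume : Measure (Eu N)).restrict Ωᶜ).support, κ ≤ volume (Metric.ball z r \ Ω) := by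
  set Z := ((volume : Measure (Eu N)).restrict Ωᶜ).support with hZ
  have hpos : ∀ z ∈ Z, 0 < volume (Metric.ball z (r / 2) \ Ω) := fun z hz => by
    have := (Measure.mem_support_iff_forall z).1 hz _ (Metric.ball_mem_nhds z (half_pos hr))
    rwa [Measure.restrict_apply Metric.isOpen_ball.measurableSet, ← sdiff_eq] at this
  obtain ⟨R, hR⟩ := hΩb.subset_ball 0
  -- Centres of norm at most `R + r` are handled by finitely many balls of radius `r / 2`, one of
  -- which lies in `ball z r`. For any other centre the whole ball misses `Ω`.
  obtain ⟨t, htK, htf, ht⟩ := Metric.finite_approx_of_totallyBounded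
    ((isCompact_closedBall (0 : Eu N) (R + r)).totallyBounded.subset
      (inter_subset_right (s := Z))) (r / 2) (half_pos hr)
  have hball0 : 0 < volume (Metric.ball (0 : Eu N) r) := Metric.measure_ball_pos _ _ hr
  refine ⟨min (volume (Metric.ball (0 : Eu N) r))
    (htf.toFinset.inf fun y => volume (Metric.ball y (r / 2) \ Ω)), (lt_min hball0 ?_).ne',
    min_le_left _ _, fun z hz => ?_⟩
  · rw [Finset.lt_inf_iff ENNReal.zero_lt_top]
    exact fun y hy => hpos y (htK (htf.mem_toFinset.1 hy)).1
  by_cases hzR : ‖z‖ ≤ R + r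
  · obtain ⟨y, hy, hzy⟩ := mem_iUnion₂.1 (ht ⟨hz, by simpa using hzR⟩)
    refine (min_le_right _ _).trans ((Finset.inf_le (htf.mem_toFinset.2 hy)).trans
      (measure_mono (sdiff_subset_sdiff_left (Metric.ball_subset_ball' ?_))))
    rw [dist_comm]
    linarith [Metric.mem_ball.1 hzy]
  · refine (min_le_left _ _).trans ?_
    rw [← Measure.addHaar_ball_center volume z r]
    refine measure_mono fun w hw => ⟨hw, fun hwΩ => hzR ?_⟩
    have h1 : ‖w‖ < R := by simpa using hR hwΩ
    have h2 : ‖w - z‖ < r := by rwa [← dist_eq_norm]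
    have h3 := norm_sub_norm_le z w
    rw [norm_sub_rev] at h3
    linarith

/-- Averages of `u` over sets of diameter comparable to a small fixed scale satisfy, by Jensen, a
Hölder bound at distances `≥ ρ`, with a loss `κ ^ (-2 / p)` that tends to `1`. Extending these
values by McShane gives `g`. For `g` to vanish off `Ω` without regularity of the boundary, every
point of the support of `volume` on `Ωᶜ` is a sample point, and there the average is taken over
`ball s r \ Ω`, where `u = 0`. The scales `ρ`, `r` and the measure bound `κ` do not depend on `p` or
`u`. -/
theorem eventually_exists_isHolder_approx {Ω : Set (Eu N)} (hΩ : MeasurableSet Ω)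
    (hΩb : Bornology.IsBounded Ω) {α : ℝ} (hα0 : 0 < α) (hα1 : α < 1) {M M' : ℝ} (hM : 0 < M)
    (hMM' : M < M') {ε : ℝ} (hε : 0 < ε) :
    ∀ᶠ p : ℝ in atTop, ∀ u : Fn N, VanishesOff Ω u →
      eLpNorm u (ENNReal.ofReal p) volume < ∞ →
      holderLp α (ENNReal.ofReal p) u ≤ ENNReal.ofReal M →
      ∃ g : Eu N → ℝ, IsHolder α M' g ∧ VanishesOff Ω g ∧
        eLpNorm (fun x => u x - g x) (ENNReal.ofReal p) volume ≤ ENNReal.ofReal ε := by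
  have hM'0 : 0 < M' := hM.trans hMM'
  obtain ⟨L, hML, hLM'⟩ := exists_between hMM'
  set η : ℝ := (L / M - 1) / 2 with hη
  have hη0 : 0 < η := by
    have : 1 < L / M := (one_lt_div hM).2 hML
    rw [hη]; linarith
  have hηL : M * (1 + 2 * η) = L := by rw [hη]; field_simp; ring
  -- `a = ρ ^ α` is chosen so that the oscillation of `u` about its averages, `2 * a * (1 + η) * M`,
  -- and that of `g` at scale `ρ`, `2 * M' * a`, are each at most `ε / 2`; the factors `2` bound `k
  -- ^ (1 / p)` and `V ^ (1 / p)`.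
  set a : ℝ := ε / (4 * (M * (1 + η) + M')) with ha
  have ha0 : 0 < a := by positivity
  set ρ : ℝ := a ^ (1 / α) with hρ
  have hρ0 : 0 < ρ := by positivity
  have hρα : ρ ^ α = a := by
    rw [hρ, ← Real.rpow_mul ha0.le, one_div_mul_cancel hα0.ne', Real.rpow_one]
  set r : ℝ := η * ρ with hr
  have hr0 : 0 < r := by positivity
  have hlin : ∀ t : ℝ, 0 ≤ t → (1 + t) ^ α ≤ 1 + t := fun t ht => by
    simpa using Real.rpow_le_rpow_of_exponent_le (by linarith : 1 ≤ 1 + t) hα1.le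
  obtain ⟨κ, hκ0, hκball, hκZ⟩ := exists_le_volume_ball_diff hΩb hr0
  have hκt : κ ≠ ∞ := ne_top_of_le_ne_top measure_ball_lt_top.ne hκball
  set k : ℝ := κ⁻¹.toReal with hk
  have hk0 : 0 < k := ENNReal.toReal_pos (ENNReal.inv_ne_zero.2 hκt) (ENNReal.inv_ne_top.2 hκ0)
  have hkκ : κ⁻¹ = ENNReal.ofReal k := (ENNReal.ofReal_toReal (ENNReal.inv_ne_top.2 hκ0)).symm
  set V : ℝ := (volume Ω).toReal + 1 with hV
  have hV0 : 0 < V := by positivity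
  have hVΩ : volume Ω ≤ ENNReal.ofReal V := by
    rw [← ENNReal.ofReal_toReal hΩb.measure_lt_top.ne]
    exact ENNReal.ofReal_le_ofReal (by linarith)
  have hlim1 : Tendsto (fun p : ℝ => (k * k) ^ (1 / p) * L) atTop (𝓝 (1 * L)) :=
    (tendsto_const_rpow_one_div (by positivity)).mul_const L
  filter_upwards [hlim1.eventually (gt_mem_nhds (by linarith : 1 * L < M')),
    (tendsto_const_rpow_one_div hk0).eventually (gt_mem_nhds one_lt_two),
    (tendsto_const_rpow_one_div hV0).eventually (gt_mem_nhds one_lt_two),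
    eventually_ge_atTop 1] with p hpL hpk hpV hp1 u hu hufin huM
  have hp0 : 0 < p := by linarith
  set Z := ((volume : Measure (Eu N)).restrict Ωᶜ).support with hZ
  classical
  set E : Eu N → Set (Eu N) := fun s => if s ∈ Z then Metric.ball s r \ Ω else Metric.ball s r
    with hE
  have hEm : ∀ s, MeasurableSet (E s) := fun s => by
    simp only [hE]
    split_ifs
    · exact Metric.isOpen_ball.measurableSet.diff hΩ
    · exact Metric.isOpen_ball.measurableSet
  have hEball : ∀ s, E s ⊆ Metric.ball s r := fun s => by
    simp only [hE]
    split_ifs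
    · exact sdiff_subset
    · exact subset_rfl
  have hEκ : ∀ s, κ ≤ volume (E s) := fun s => by
    simp only [hE]
    split_ifs with h
    · exact hκZ s h
    · rwa [Measure.addHaar_ball_center]
  have hEf : ∀ s, volume (E s) ≠ ∞ := fun s =>
    ((measure_mono (hEball s)).trans_lt measure_ball_lt_top).ne
  set f : Eu N → ℝ := fun s => ∫ y, u y ∂(ProbabilityTheory.cond volume (E s)) with hf
  have hfZ : ∀ s ∈ Z, f s = 0 := fun s hs => by
    refine integral_eq_zero_of_ae ?_
    have h1 : ∀ᵐ y ∂(volume.restrict (E s)), u y = 0 := by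
      filter_upwards [ae_restrict_of_ae hu, ae_restrict_mem (hEm s)] with y hy hyE
      refine hy ?_
      simp only [hE, if_pos hs] at hyE
      exact hyE.2
    exact Measure.ae_smul_measure h1 _
  obtain ⟨S, hZS, hSsep, hScov⟩ := exists_separated_superset Z (ρ := ρ)
  have hfS : ∀ s ∈ S, ∀ t ∈ S, |f s - f t| ≤ M' * dist s t ^ α := by
    intro s hs t ht
    have hnn : 0 ≤ M' * dist s t ^ α := by positivity
    rcases eq_or_ne s t with rfl | hst
    · rwa [sub_self, abs_zero]
    rcases hSsep s hs t ht hst with ⟨hsZ, htZ⟩ | hdist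
    · rwa [hfZ s hsZ, hfZ t htZ, sub_self, abs_zero]
    have hd : ∀ x ∈ E s, ∀ y ∈ E t, dist x y ≤ dist s t + 2 * r := fun x hx y hy => by
      have h1 := Metric.mem_ball.1 (hEball s hx)
      have h2 := Metric.mem_ball.1 (hEball t hy)
      have h3 := dist_triangle4 x s t y
      rw [dist_comm t y] at h3
      linarith
    have hmain := enorm_average_sub_average_rpow_le hα0.le hp1 u hufin (hEm s) (hEm t) hκ0
      (hEκ s) (hEκ t) (hEf s) (hEf t) hd
    -- The separation `ρ ≤ dist s t` makes `2 * r = 2 * η * ρ` a small fraction of the distance.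
    -- Closer pairs lie in `Z`, where `f` vanishes.
    have hdα : (dist s t + 2 * r) ^ α ≤ dist s t ^ α * (1 + 2 * η) := by
      have h1 : dist s t + 2 * r ≤ dist s t * (1 + 2 * η) := by
        rw [hr]
        nlinarith
      refine (Real.rpow_le_rpow (by positivity) h1 hα0.le).trans ?_
      rw [Real.mul_rpow dist_nonneg (by positivity)]
      gcongr
      exact hlin _ (by positivity)
    have hbd : ‖f s - f t‖ₑ ≤
        ENNReal.ofReal ((k * k) ^ (1 / p) * (dist s t + 2 * r) ^ α * M) := by
      rw [← ENNReal.rpow_le_rpow_iff hp0]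
      refine hmain.trans ?_
      rw [ENNReal.ofReal_mul (by positivity), ENNReal.ofReal_mul (by positivity),
        ENNReal.mul_rpow_of_nonneg _ _ hp0.le, ENNReal.mul_rpow_of_nonneg _ _ hp0.le,
        ENNReal.ofReal_rpow_of_nonneg (p := p) (x := (k * k) ^ (1 / p)) (by positivity) hp0.le,
        ← Real.rpow_mul (by positivity),
        one_div_mul_cancel hp0.ne', Real.rpow_one, ENNReal.ofReal_mul hk0.le, ← hkκ]
      gcongr
    rw [Real.enorm_eq_ofReal_abs, ENNReal.ofReal_le_ofReal_iff (by positivity)] at hbd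
    calc |f s - f t| ≤ (k * k) ^ (1 / p) * (dist s t + 2 * r) ^ α * M := hbd
      _ ≤ (k * k) ^ (1 / p) * (dist s t ^ α * (1 + 2 * η)) * M := by gcongr
      _ = ((k * k) ^ (1 / p) * L) * dist s t ^ α := by rw [← hηL]; ring
      _ ≤ M' * dist s t ^ α := by gcongr
  obtain ⟨g, hg, hgS⟩ := exists_isHolder_extension hα0 hα1.le hM'0.le hfS
  have hgv : VanishesOff Ω g := by
    have h1 : ∀ᵐ x ∂(volume : Measure (Eu N)), x ∈ Ωᶜ → x ∈ Z :=
      (ae_restrict_iff' hΩ.compl).1 Measure.support_mem_ae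
    filter_upwards [h1] with x hx hxΩ
    rw [hgS x (hZS (hx hxΩ)), hfZ x (hx hxΩ)]
  refine ⟨g, hg, hgv, ?_⟩
  set H : Eu N → ℝ≥0∞ := fun x => ∫⁻ y, ‖holderQuotient α u (x, y)‖ₑ ^ p with hH
  have hum : Measurable (u : Eu N → ℝ) := u.stronglyMeasurable.measurable
  have hqm : Measurable (holderQuotient α (u : Eu N → ℝ)) := by
    unfold holderQuotient
    fun_prop
  have hHm : Measurable H := Measurable.lintegral_prod_right' (hqm.enorm.pow_const p)
  have hHint : ∫⁻ x, H x = holderLp α (ENNReal.ofReal p) u ^ p := by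
    rw [holderLp_rpow_eq_lintegral α hp0, lintegral_prod _ (hqm.enorm.pow_const p).aemeasurable]
  -- `A` bounds the distance of `u x` to the average at a nearby sample point, whichever that point
  -- is; integrating `A ^ p` in `x` recovers the full double integral.
  set A : Eu N → ℝ≥0∞ := fun x =>
    (κ⁻¹ * ENNReal.ofReal ((ρ + r) ^ α) ^ p * H x) ^ (1 / p) with hA
  set B : Eu N → ℝ≥0∞ := fun _ => ENNReal.ofReal (M' * a) with hB
  have hAm : Measurable A := (hHm.const_mul _).pow_const _
  have hpt : ∀ x, ‖u x - g x‖ₑ ≤ A x + B x := by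
    intro x
    obtain ⟨s, hs, hxs⟩ := hScov hρ0 x
    have h1 : ‖u x - f s‖ₑ ≤ A x := by
      rw [hA, one_div, ENNReal.le_rpow_inv_iff hp0]
      refine enorm_sub_average_rpow_le hα0.le hp1 u hufin (hEm s) hκ0 (hEκ s) (hEf s)
        fun y hy => ?_
      have h2 := Metric.mem_ball.1 (hEball s hy)
      have h3 := dist_triangle x s y
      rw [dist_comm s y] at h3
      linarith
    have h2 : ‖f s - g x‖ₑ ≤ B x := by
      rw [Real.enorm_eq_ofReal_abs, ← hgS s hs]
      refine ENNReal.ofReal_le_ofReal ((hg s x).trans ?_)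
      rw [← hρα, dist_comm]
      gcongr
    calc ‖u x - g x‖ₑ = ‖(u x - f s) + (f s - g x)‖ₑ := by rw [sub_add_sub_cancel]
      _ ≤ ‖u x - f s‖ₑ + ‖f s - g x‖ₑ := enorm_add_le _ _
      _ ≤ A x + B x := add_le_add h1 h2
  have hpe : (1 : ℝ≥0∞) ≤ ENNReal.ofReal p := by simpa using hp1
  have hpe0 : ENNReal.ofReal p ≠ 0 := (ENNReal.ofReal_pos.2 hp0).ne'
  have hAn : eLpNorm A (ENNReal.ofReal p) (volume.restrict Ω) ≤ ENNReal.ofReal (ε / 2) := by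
    refine (eLpNorm_mono_measure A Measure.restrict_le_self).trans ?_
    rw [eLpNorm_eq_lintegral_rpow_enorm_toReal hpe0 ENNReal.ofReal_ne_top,
      ENNReal.toReal_ofReal hp0.le]
    simp only [hA, enorm_eq_self, ← ENNReal.rpow_mul, one_div_mul_cancel hp0.ne', ENNReal.rpow_one]
    rw [lintegral_const_mul _ hHm, hHint, ENNReal.mul_rpow_of_nonneg _ _ (by positivity),
      ENNReal.mul_rpow_of_nonneg _ _ (by positivity), ← ENNReal.rpow_mul, ← ENNReal.rpow_mul,
      mul_one_div_cancel hp0.ne', ENNReal.rpow_one, ENNReal.rpow_one, hkκ,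
      ENNReal.ofReal_rpow_of_pos hk0]
    refine (mul_le_mul_right huM _).trans ?_
    rw [← ENNReal.ofReal_mul (by positivity), ← ENNReal.ofReal_mul (by positivity)]
    refine ENNReal.ofReal_le_ofReal ?_
    have h1 : (ρ + r) ^ α ≤ a * (1 + η) := by
      rw [show ρ + r = ρ * (1 + η) by rw [hr]; ring, Real.mul_rpow hρ0.le (by positivity), hρα]
      gcongr
      exact hlin _ hη0.le
    calc k ^ (1 / p) * (ρ + r) ^ α * M ≤ 2 * (a * (1 + η)) * M := by gcongr
      _ ≤ ε / 2 := by
        rw [ha]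
        have : 0 < M * (1 + η) := by positivity
        rw [show 2 * (ε / (4 * (M * (1 + η) + M')) * (1 + η)) * M =
          (ε / 2) * ((M * (1 + η)) / (M * (1 + η) + M')) by field_simp; ring]
        refine mul_le_of_le_one_right (by positivity) ?_
        rw [div_le_one (by positivity)]
        linarith
  have hBn : eLpNorm B (ENNReal.ofReal p) (volume.restrict Ω) ≤ ENNReal.ofReal (ε / 2) := by
    rw [hB, eLpNorm_const' _ hpe0 ENNReal.ofReal_ne_top, ENNReal.toReal_ofReal hp0.le,
      Measure.restrict_apply_univ, enorm_eq_self]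
    refine (mul_le_mul_right (ENNReal.rpow_le_rpow hVΩ (by positivity)) _).trans ?_
    rw [ENNReal.ofReal_rpow_of_pos hV0, ← ENNReal.ofReal_mul (by positivity)]
    refine ENNReal.ofReal_le_ofReal ?_
    calc M' * a * V ^ (1 / p) ≤ M' * a * 2 := by gcongr
      _ ≤ ε / 2 := by
        rw [ha, show M' * (ε / (4 * (M * (1 + η) + M'))) * 2 =
          (ε / 2) * (M' / (M * (1 + η) + M')) by field_simp; ring]
        refine mul_le_of_le_one_right (by positivity) ?_
        have : 0 < M * (1 + η) := by positivity
        rw [div_le_one (by positivity)]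
        linarith
  have hdiff : VanishesOff Ω (fun x => u x - g x) := by
    filter_upwards [hu, hgv] with x h1 h2 hx
    rw [h1 hx, h2 hx, sub_zero]
  rw [hdiff.eLpNorm_eq_restrict hΩ]
  calc eLpNorm (fun x => u x - g x) (ENNReal.ofReal p) (volume.restrict Ω)
      ≤ eLpNorm (A + B) (ENNReal.ofReal p) (volume.restrict Ω) :=
        eLpNorm_mono_enorm fun x => by simpa using hpt x
    _ ≤ eLpNorm A (ENNReal.ofReal p) (volume.restrict Ω) +
        eLpNorm B (ENNReal.ofReal p) (volume.restrict Ω) :=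
        eLpNorm_add_le hAm.aestronglyMeasurable measurable_const.aestronglyMeasurable hpe
    _ ≤ ENNReal.ofReal (ε / 2) + ENNReal.ofReal (ε / 2) := add_le_add hAn hBn
    _ = ENNReal.ofReal ε := by
        rw [← ENNReal.ofReal_add (by positivity) (by positivity), add_halves]

end

theorem IsExtSeminorm.add {V : Type*} [AddCommGroup V] [Module ℝ V] {q q' : V → ℝ≥0∞}
    (h : IsExtSeminorm q) (h' : IsExtSeminorm q') : IsExtSeminorm fun u => q u + q' u where
  add_le u v := (add_le_add (h.add_le u v) (h'.add_le u v)).trans_eq (by ring)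
  smul c u := by rw [h.smul, h'.smul, mul_add]

section

variable {N : ℕ} {Ω : Set (Eu N)} {α : ℝ}

/-! ### Sublevel sets on the unit spheres -/

/-- The functions in `W^{s,p}_0(Ω)`, `s = α - N / p`, with `‖u‖_p = 1` and `‖D^α u‖_p ≤ M`. -/
def sobolevSublevel (Ω : Set (Eu N)) (α p M : ℝ) : Set (Fn N) :=
  {u | VanishesOff Ω u ∧ eLpNorm u (ENNReal.ofReal p) volume = 1 ∧
    holderLp α (ENNReal.ofReal p) u ≤ ENNReal.ofReal M}

/-- The functions in `W^{α,∞}_0(Ω)` with `‖u‖_∞ = 1` and `‖D^α u‖_∞ ≤ M`. -/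
def holderSublevel (Ω : Set (Eu N)) (α M : ℝ) : Set (Fn N) :=
  {u | VanishesOff Ω u ∧ eLpNorm u ∞ volume = 1 ∧ holderSeminorm α u ≤ ENNReal.ofReal M}

/-- Each defining condition is closed under a seminorm dominated by `sobolevNorm`. Taking the full
sublevel set as competitor avoids any question whether the image of a closed set under an odd map is
closed. -/
theorem sobolevSublevel_mem_minimaxClass (hΩ : MeasurableSet Ω) {p M : ℝ} (hp : 1 ≤ p) {k : ℕ}
    (hne : (sobolevSublevel Ω α p M).Nonempty)
    (hk : (k : ℕ∞) ≤ @genus _ (normTopology (sobolevNorm (N := N) (α - N / p) p)) _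
      (sobolevSublevel Ω α p M)) :
    sobolevSublevel Ω α p M ∈ minimaxClass (sobolevZero Ω (α - N / p) p)
      (sobolevNorm (α - N / p) p) (fun u => eLpNorm u (ENNReal.ofReal p) volume) k := by
  have hp0 : 0 < p := by linarith
  have hpe : 1 ≤ ENNReal.ofReal p := by simpa using hp
  have hL := isExtSeminorm_eLpNorm (N := N) hpe
  have hD := isExtSeminorm_holderLp (N := N) α hpe
  refine ⟨fun u hu => ⟨hu.2.1.trans_lt ENNReal.one_lt_top, ?_, hu.1⟩, hne,
    fun u hu => ⟨hu.1.neg, (hL.neg u).trans hu.2.1, (hD.neg u).trans_le hu.2.2⟩,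
    isClosed_normTopology fun u h => ⟨?_, ?_, ?_⟩, ⟨1 + M.toNNReal, fun u hu => ?_⟩,
    fun u hu => hu.2.1, hk⟩
  · rw [gagliardoPow_eq α hp0]
    exact ENNReal.rpow_lt_top_of_nonneg hp0.le (hu.2.2.trans_lt ENNReal.ofReal_lt_top).ne
  · refine VanishesOff.of_forall_close hΩ (ENNReal.ofReal_pos.2 hp0).ne' fun ε hε => ?_
    obtain ⟨v, hv, hvu⟩ := h ε hε
    exact ⟨v, hv.1, (eLpNorm_le_sobolevNorm hp0 _).trans_lt hvu⟩
  · refine hL.eq_of_forall_close fun ε hε => ?_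
    obtain ⟨v, hv, hvu⟩ := h ε hε
    exact ⟨v, hv.2.1, (eLpNorm_le_sobolevNorm hp0 _).trans_lt hvu⟩
  · refine hD.le_of_forall_close fun ε hε => ?_
    obtain ⟨v, hv, hvu⟩ := h ε hε
    exact ⟨v, hv.2.2, (holderLp_le_sobolevNorm hp0 _).trans_lt hvu⟩
  · refine (sobolevNorm_le_add hp u).trans ?_
    rw [hu.2.1, ENNReal.coe_add, ENNReal.coe_one]
    exact add_le_add le_rfl hu.2.2

theorem holderSublevel_mem_minimaxClass (hΩ : MeasurableSet Ω) {M : ℝ} {k : ℕ}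
    (hne : (holderSublevel Ω α M).Nonempty)
    (hk : (k : ℕ∞) ≤ @genus _ (normTopology (holderNorm (N := N) α)) _ (holderSublevel Ω α M)) :
    holderSublevel Ω α M ∈ minimaxClass (holderZero Ω α) (holderNorm α)
      (fun u => eLpNorm u ∞ volume) k := by
  have hL := isExtSeminorm_eLpNorm (N := N) (p := ∞) le_top
  have hD := isExtSeminorm_holderLp (N := N) α (p := ∞) le_top
  refine ⟨fun u hu => ⟨hu.2.1.trans_lt ENNReal.one_lt_top, hu.2.2.trans_lt ENNReal.ofReal_lt_top,
    hu.1⟩, hne,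
    fun u hu => ⟨hu.1.neg, (hL.neg u).trans hu.2.1, (hD.neg u).trans_le hu.2.2⟩,
    isClosed_normTopology fun u h => ⟨?_, ?_, ?_⟩, ⟨max 1 M.toNNReal, fun u hu => ?_⟩,
    fun u hu => hu.2.1, hk⟩
  · refine VanishesOff.of_forall_close hΩ ENNReal.top_ne_zero fun ε hε => ?_
    obtain ⟨v, hv, hvu⟩ := h ε hε
    exact ⟨v, hv.1, (le_max_left _ _).trans_lt hvu⟩
  · refine hL.eq_of_forall_close fun ε hε => ?_
    obtain ⟨v, hv, hvu⟩ := h ε hε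
    exact ⟨v, hv.2.1, (le_max_left _ _).trans_lt hvu⟩
  · refine hD.le_of_forall_close fun ε hε => ?_
    obtain ⟨v, hv, hvu⟩ := h ε hε
    exact ⟨v, hv.2.2, (le_max_right _ _).trans_lt hvu⟩
  · rw [holderNorm, hu.2.1, ENNReal.coe_max, ENNReal.coe_one]
    exact max_le_max le_rfl hu.2.2

theorem IsExtSeminorm.inv_toReal_smul {V : Type*} [AddCommGroup V] [Module ℝ V] {q : V → ℝ≥0∞}
    (hq : IsExtSeminorm q) {u : V} {a : ℝ≥0∞} (ha0 : a ≠ 0) (ha : a ≠ ∞) :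
    q (a.toReal⁻¹ • u) = a⁻¹ * q u := by
  rw [hq.smul, enorm_inv (ENNReal.toReal_pos ha0 ha).ne', Real.enorm_of_nonneg
    ENNReal.toReal_nonneg, ENNReal.ofReal_toReal ha]

/-! ### The upper bound -/

/-- A nearly optimal set for the limit problem is mapped into the Sobolev sublevel set by
normalizing in `L^p`; continuity holds because the Hölder norm controls both `L^p` norms on
functions vanishing off `Ω`. -/
theorem eventually_eigenvalue_le (hΩ : MeasurableSet Ω) (hΩf : volume Ω ≠ ∞) (hα0 : 0 < α)
    (hα1 : α < 1) {k : ℕ} {M M' : ℝ} (hM : 0 < M) (hMM' : M < M')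
    (h : limitEigenvalue (holderZero Ω α) α k < ENNReal.ofReal M) :
    ∀ᶠ p : ℝ in atTop, eigenvalue Ω (α - N / p) p k ^ (1 / p) ≤ ENNReal.ofReal M' := by
  simp only [limitEigenvalue, iInf_lt_iff] at h
  obtain ⟨G, hG, hGM⟩ := h
  obtain ⟨hGX, hGne, hGneg, -, -, hG1, hGk⟩ := hG
  replace hG1 : ∀ v ∈ G, eLpNorm v ∞ volume = 1 := hG1
  have hGs : ∀ v ∈ G, holderSeminorm α v ≤ ENNReal.ofReal M := fun v hv => by
    have h1 := (le_iSup₂ (f := fun (v : Fn N) (_ : v ∈ G) =>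
      holderSeminorm α v / eLpNorm v ∞ volume) v hv).trans hGM.le
    rwa [hG1 v hv, div_one] at h1
  filter_upwards [eventually_holderLp_le hΩ hΩf hα0 hα1 hM hMM', eventually_ge_atTop 1,
    eventually_gt_atTop (N / α)] with p hp hp1 hpα
  have hp0 : 0 < p := by linarith
  have hpe : 1 ≤ ENNReal.ofReal p := by simpa using hp1
  have hαp : N < α * p := by rwa [div_lt_iff₀' hα0] at hpα
  have hL := isExtSeminorm_eLpNorm (N := N) hpe
  have hD := isExtSeminorm_holderLp (N := N) α hpe
  have hGL : ∀ v ∈ G, eLpNorm v (ENNReal.ofReal p) volume ≠ ∞ := fun v hv => by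
    refine ne_top_of_le_ne_top ?_ 
      (VanishesOff.eLpNorm_le hΩ (hGX hv).2.2 v.aestronglyMeasurable hp0)
    rw [hG1 v hv, one_mul]
    exact ENNReal.rpow_ne_top_of_nonneg (by positivity) hΩf
  have hGp := fun v hv => hp v (hGX hv).2.2 (hG1 v hv) (hGs v hv)
  have hGD : ∀ v ∈ G, holderLp α (ENNReal.ofReal p) v ≠ ∞ := fun v hv =>
    ne_top_of_le_ne_top (ENNReal.mul_ne_top ENNReal.ofReal_ne_top (hGL v hv)) (hGp v hv).2
  set f : Fn N → Fn N := fun v => (eLpNorm v (ENNReal.ofReal p) volume).toReal⁻¹ • v with hf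
  have hmaps : MapsTo f G (sobolevSublevel Ω α p M') := fun v hv => by
    refine ⟨VanishesOff.smul (hGX hv).2.2 _, ?_, ?_⟩
    · exact (hL.inv_toReal_smul (hGp v hv).1 (hGL v hv)).trans
        (ENNReal.inv_mul_cancel (hGp v hv).1 (hGL v hv))
    · refine (hD.inv_toReal_smul (hGp v hv).1 (hGL v hv)).trans_le ?_
      rw [mul_comm, ← div_eq_mul_inv]
      exact ENNReal.div_le_of_le_mul (hGp v hv).2
  obtain ⟨C, hC, hCle⟩ := exists_holderLp_le_holderNorm hΩ hΩf hα0 hα1 hp0 hαp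
  set q : Fn N → ℝ≥0∞ := fun u =>
    eLpNorm u (ENNReal.ofReal p) volume + holderLp α (ENNReal.ofReal p) u with hq
  have hqs : IsExtSeminorm q := hL.add hD
  have hGh : ∀ v ∈ G, holderNorm α v ≠ ∞ := fun v hv =>
    (max_lt (hGX hv).1 (hGX hv).2.1).ne
  have hid : @ContinuousOn _ _ (normTopology (holderNorm α)) (normTopology q) (fun u => u) G := by
    let := normTopology (holderNorm (N := N) α)
    refine continuousOn_normTopology_of_eventually fun u hu ε hε => ?_
    set K : ℝ≥0∞ := volume Ω ^ (1 / p) + C with hK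
    have hKt : K ≠ ∞ := ENNReal.add_ne_top.2
      ⟨ENNReal.rpow_ne_top_of_nonneg (by positivity) hΩf, hC⟩
    have hlim : Tendsto (fun v => K * holderNorm α (v - u)) (𝓝[G] u) (𝓝 (K * 0)) :=
      ENNReal.Tendsto.const_mul (ENNReal.tendsto_nhds_zero.2 fun δ hδ => nhdsWithin_le_nhds
        (((isExtSeminorm_holderNorm α).eventually_sub_lt u hδ).mono fun _ => le_of_lt))
        (Or.inr hKt)
    rw [mul_zero] at hlim
    filter_upwards [hlim.eventually (gt_mem_nhds hε), self_mem_nhdsWithin] with v hv hvG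
    refine lt_of_le_of_lt ?_ hv
    have hvu : VanishesOff Ω ((v - u : Fn N) : Eu N → ℝ) :=
      VanishesOff.sub (hGX hvG).2.2 (hGX hu).2.2
    have hfin : holderNorm α (v - u) ≠ ∞ := ne_top_of_le_ne_top
      (ENNReal.add_ne_top.2 ⟨hGh v hvG, hGh u hu⟩) ((isExtSeminorm_holderNorm α).sub_le v u)
    rw [hK, add_mul]
    refine add_le_add ((hvu.eLpNorm_le hΩ (AEEqFun.aestronglyMeasurable _) hp0).trans ?_)
      (hCle _ hvu hfin)
    rw [mul_comm]
    gcongr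
    exact le_max_left _ _
  have hcont : @ContinuousOn _ _ (normTopology (holderNorm α))
      (normTopology (sobolevNorm (α - N / p) p)) f G := by
    let := normTopology (holderNorm (N := N) α)
    have h1 : ContinuousOn (fun u : Fn N => (eLpNorm u (ENNReal.ofReal p) volume).toReal) G :=
      @ContinuousOn.comp _ _ _ _ (normTopology fun u : Fn N => eLpNorm u (ENNReal.ofReal p) volume)
        _ _ _ _ _ (hL.continuousOn_toReal hGL)
        (hid.mono_rng (normTopology_anti fun u => le_self_add)) (mapsTo_id G)
    have h2 := h1.inv₀ fun u hu => (ENNReal.toReal_pos (hGp u hu).1 (hGL u hu)).ne'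
    exact (hqs.continuousOn_smul h2 hid fun u hu => ENNReal.add_ne_top.2
      ⟨hGL u hu, hGD u hu⟩).mono_rng (normTopology_anti fun u => sobolevNorm_le_add hp1 u)
  have hgenus := @genus_le_of_continuousOn _ _ (normTopology (holderNorm α))
    (normTopology (sobolevNorm (α - N / p) p)) _ _ f G _ hcont (fun u _ => by
      simp only [hf]
      rw [show eLpNorm ((-u : Fn N) : Eu N → ℝ) (ENNReal.ofReal p) volume =
        eLpNorm u (ENNReal.ofReal p) volume from hL.neg u, smul_neg]) hmaps
  have hmem := sobolevSublevel_mem_minimaxClass hΩ hp1 (hmaps.nonempty hGne) (hGk.trans hgenus)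
  rw [one_div, ENNReal.rpow_inv_le_iff hp0]
  refine (iInf₂_le _ hmem).trans (iSup₂_le fun v hv => ?_)
  rw [hv.2.1, ENNReal.one_rpow, div_one, gagliardoPow_eq α hp0]
  calc ENNReal.ofReal (1 - (α - N / p)) * holderLp α (ENNReal.ofReal p) v ^ p
      ≤ 1 * ENNReal.ofReal M' ^ p := by
        gcongr
        -- `1 - s ≤ 1`, because `s = α - N/p ≥ 0`.
        · rw [ENNReal.ofReal_le_one, sub_le_self_iff, sub_nonneg, div_le_iff₀ hp0]
          exact hαp.le
        · exact hv.2.2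
    _ = ENNReal.ofReal M' ^ p := one_mul _

/-! ### The lower bound -/

/-- A finite net of Hölder functions for the `L^p` norms, for all large `p`. -/
theorem exists_finset_net (hN : 1 ≤ N) (hΩ : MeasurableSet Ω) (hΩb : Bornology.IsBounded Ω)
    (hα0 : 0 < α) (hα1 : α < 1) {M M' : ℝ} (hM : 0 < M) (hMM' : M < M') {ε : ℝ} (hε : 0 < ε) :
    ∃ F : Finset (Fn N), (∀ v ∈ F, v ∈ holderZero Ω α ∧ holderSeminorm α v ≤ ENNReal.ofReal M') ∧
      ∀ᶠ p : ℝ in atTop, ∀ u : Fn N, VanishesOff Ω u →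
        eLpNorm u (ENNReal.ofReal p) volume < ∞ →
        holderLp α (ENNReal.ofReal p) u ≤ ENNReal.ofReal M →
        ∃ v ∈ F, eLpNorm ((u - v : Fn N) : Eu N → ℝ) (ENNReal.ofReal p) volume ≤
          ENNReal.ofReal ε := by
  classical
  have hM'0 : 0 < M' := hM.trans hMM'
  -- The net is fixed before `p`. Sup-norm accuracy `ε / 4` becomes `L^p` accuracy `ε / 2` once `V ^
  -- (1 / p) < 2`, with `V ≥ |Ω|`.
  obtain ⟨F, hFf, hF, hnet⟩ := exists_finite_holder_net hN hΩb hα0 hM'0.le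
    (by positivity : 0 < ε / 4)
  obtain ⟨C, hC⟩ := exists_abs_le_of_isHolder hN hΩb hα0 hM'0.le
  set j : (Eu N → ℝ) → Fn N := fun g =>
    if hg : AEStronglyMeasurable g volume then AEEqFun.mk g hg else 0 with hj
  have hjF : ∀ g ∈ F, j g =ᵐ[volume] g := fun g hg => by
    have hgm : AEStronglyMeasurable g (volume : Measure (Eu N)) :=
      ((hF g hg).1.continuous hα0).aestronglyMeasurable
    simp only [hj, dif_pos hgm]
    exact AEEqFun.coeFn_mk g hgm
  refine ⟨hFf.toFinset.image j, fun v hv => ?_, ?_⟩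
  · obtain ⟨g, hg, rfl⟩ := Finset.mem_image.1 hv
    rw [hFf.mem_toFinset] at hg
    have hs : holderSeminorm α (j g) ≤ ENNReal.ofReal M' :=
      (holderLp_congr α ∞ (hjF g hg)).trans_le ((hF g hg).1.holderSeminorm_le hM'0.le)
    refine ⟨⟨?_, hs.trans_lt ENNReal.ofReal_lt_top, VanishesOff.congr (hF g hg).2 (hjF g hg)⟩, hs⟩
    refine lt_of_le_of_lt ?_ (ENNReal.ofReal_lt_top (r := max C 0))
    rw [eLpNorm_exponent_top]
    refine eLpNormEssSup_le_of_ae_bound ?_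
    filter_upwards [hjF g hg, (hF g hg).2] with x hx hx0
    rw [hx]
    by_cases hxΩ : x ∈ Ω
    · exact (hC g (hF g hg).1 (hF g hg).2 x hxΩ).trans (le_max_left _ _)
    · rw [hx0 hxΩ, norm_zero]
      exact le_max_right _ _
  · set V : ℝ := (volume Ω).toReal + 1 with hV
    have hV0 : 0 < V := by positivity
    have hVΩ : volume Ω ≤ ENNReal.ofReal V := by
      rw [← ENNReal.ofReal_toReal hΩb.measure_lt_top.ne]
      exact ENNReal.ofReal_le_ofReal (by linarith)
    filter_upwards [eventually_exists_isHolder_approx hΩ hΩb hα0 hα1 hM hMM' (half_pos hε),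
      (tendsto_const_rpow_one_div hV0).eventually (gt_mem_nhds one_lt_two),
      eventually_ge_atTop 1] with p hp hpV hp1 u hu hufin huM
    have hp0 : 0 < p := by linarith
    have hpe : 1 ≤ ENNReal.ofReal p := by simpa using hp1
    obtain ⟨g, hg, hgv, hug⟩ := hp u hu hufin huM
    obtain ⟨f, hf, hgf⟩ := hnet g hg hgv
    refine ⟨j f, Finset.mem_image_of_mem j (hFf.mem_toFinset.2 hf), ?_⟩
    have hgm : AEStronglyMeasurable g (volume : Measure (Eu N)) :=
      (hg.continuous hα0).aestronglyMeasurable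
    have hfm : AEStronglyMeasurable f (volume : Measure (Eu N)) :=
      ((hF f hf).1.continuous hα0).aestronglyMeasurable
    have hgfv : VanishesOff Ω (g - f) := by
      filter_upwards [hgv, (hF f hf).2] with x h1 h2 hx
      rw [Pi.sub_apply, h1 hx, h2 hx, sub_zero]
    have hgf' : eLpNorm (g - f) (ENNReal.ofReal p) volume ≤ ENNReal.ofReal (ε / 2) := by
      refine (hgfv.eLpNorm_le hΩ (hgm.sub hfm) hp0).trans ?_
      have h1 : eLpNorm (g - f) ∞ volume ≤ ENNReal.ofReal (ε / 4) := by
        rw [eLpNorm_exponent_top]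
        refine eLpNormEssSup_le_of_ae_bound ?_
        filter_upwards [hgfv] with x hx
        by_cases hxΩ : x ∈ Ω
        · exact hgf x hxΩ
        · rw [hx hxΩ, norm_zero]
          positivity
      refine (mul_le_mul' h1 (ENNReal.rpow_le_rpow hVΩ (by positivity))).trans ?_
      rw [ENNReal.ofReal_rpow_of_pos hV0, ← ENNReal.ofReal_mul (by positivity)]
      refine ENNReal.ofReal_le_ofReal ?_
      calc ε / 4 * V ^ (1 / p) ≤ ε / 4 * 2 := by gcongr
        _ = ε / 2 := by ring
    have heq : ((u - j f : Fn N) : Eu N → ℝ) =ᵐ[volume] (fun x => u x - g x) + (g - f) := by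
      filter_upwards [AEEqFun.coeFn_sub u (j f), hjF f hf] with x h1 h2
      rw [h1, Pi.sub_apply, h2, Pi.add_apply, Pi.sub_apply, sub_add_sub_cancel]
    rw [eLpNorm_congr_ae heq]
    refine (eLpNorm_add_le (u.aestronglyMeasurable.sub hgm) (hgm.sub hfm) hpe).trans
      ((add_le_add hug hgf').trans_eq ?_)
    rw [← ENNReal.ofReal_add (by positivity) (by positivity), add_halves]

set_option maxHeartbeats 800000 in
theorem eventually_limitEigenvalue_le (hN : 1 ≤ N) (hΩ : MeasurableSet Ω)
    (hΩb : Bornology.IsBounded Ω) (hα0 : 0 < α) (hα1 : α < 1) {k : ℕ} {M M' : ℝ} (hM : 0 < M)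
    (hMM' : M < M') :
    ∀ᶠ p : ℝ in atTop, eigenvalue Ω (α - N / p) p k ^ (1 / p) < ENNReal.ofReal M →
      limitEigenvalue (holderZero Ω α) α k ≤ ENNReal.ofReal M' := by
  -- The gap is spent in three places: `M₁` absorbs the factor `(1 - α) ^ (1 / p)`, `M₂` the Hölder
  -- approximation, and `M'` the normalization by `‖T u‖_∞ ≥ θ = M₂ / M'`.
  obtain ⟨M₁, hMM₁, h₁⟩ := exists_between hMM'
  obtain ⟨M₂, hM₁₂, hM₂'⟩ := exists_between h₁
  have hM₁0 : 0 < M₁ := hM.trans hMM₁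
  have hM₂0 : 0 < M₂ := hM₁0.trans hM₁₂
  have hM'0 : 0 < M' := hM.trans hMM'
  set θ : ℝ := M₂ / M' with hθ
  have hθ0 : 0 < θ := by positivity
  have hθ1 : θ < 1 := (div_lt_one hM'0).2 hM₂'
  set ε : ℝ := (1 - θ) / 2 with hε
  have hε0 : 0 < ε := by rw [hε]; linarith
  obtain ⟨F, hF, hnet⟩ := exists_finset_net hN hΩ hΩb hα0 hα1 hM₁0 hM₁₂ (half_pos hε0)
  set V : ℝ := (volume Ω).toReal + 1 with hV
  have hV0 : 0 < V := by positivity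
  have hVΩ : volume Ω ≤ ENNReal.ofReal V := by
    rw [← ENNReal.ofReal_toReal hΩb.measure_lt_top.ne]
    exact ENNReal.ofReal_le_ofReal (by linarith)
  have hα1' : 0 < 1 - α := by linarith
  have hlim1 : Tendsto (fun p : ℝ => (1 - α) ^ (1 / p) * M₁) atTop (𝓝 (1 * M₁)) :=
    (tendsto_const_rpow_one_div hα1').mul_const _
  have hlim2 : Tendsto (fun p : ℝ => θ * V ^ (1 / p)) atTop (𝓝 (θ * 1)) :=
    (tendsto_const_rpow_one_div hV0).const_mul _
  filter_upwards [hnet, hlim1.eventually (lt_mem_nhds (by linarith : M < 1 * M₁)),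
    hlim2.eventually (gt_mem_nhds (by rw [hε]; linarith : θ * 1 < 1 - ε)),
    eventually_ge_atTop 1] with p hnet hpα hpV hp1 hlt
  have hp0 : 0 < p := by linarith
  have hpe : 1 ≤ ENNReal.ofReal p := by simpa using hp1
  have hL := isExtSeminorm_eLpNorm (N := N) hpe
  have hI := isExtSeminorm_eLpNorm (N := N) (p := ∞) le_top
  have hD := isExtSeminorm_holderLp (N := N) α (p := ∞) le_top
  have hH := isExtSeminorm_holderNorm (N := N) α
  rw [one_div, ENNReal.rpow_inv_lt_iff hp0] at hlt
  simp only [eigenvalue, iInf_lt_iff] at hlt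
  obtain ⟨G, ⟨hGX, hGne, hGneg, -, -, hG1, hGk⟩, hGM⟩ := hlt
  replace hG1 : ∀ u ∈ G, eLpNorm u (ENNReal.ofReal p) volume = 1 := hG1
  have hGD : ∀ u ∈ G, holderLp α (ENNReal.ofReal p) u ≤ ENNReal.ofReal M₁ := fun u hu => by
    have h1 := (le_iSup₂ (f := fun (v : Fn N) (_ : v ∈ G) =>
      ENNReal.ofReal (1 - (α - N / p)) * gagliardoPow (α - N / p) p v /
        eLpNorm v (ENNReal.ofReal p) volume ^ p) u hu).trans hGM.le
    rw [hG1 u hu, ENNReal.one_rpow, div_one, gagliardoPow_eq α hp0] at h1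
    have h2 : ENNReal.ofReal (1 - α) ≤ ENNReal.ofReal (1 - (α - N / p)) := by
      refine ENNReal.ofReal_le_ofReal ?_
      have : 0 ≤ N / p := by positivity
      linarith
    have h3 : ENNReal.ofReal M ^ p ≤ ENNReal.ofReal (1 - α) * ENNReal.ofReal M₁ ^ p := by
      rw [ENNReal.ofReal_rpow_of_pos hM, ENNReal.ofReal_rpow_of_pos hM₁0,
        ← ENNReal.ofReal_mul hα1'.le]
      refine ENNReal.ofReal_le_ofReal ((Real.rpow_le_rpow hM.le hpα.le hp0.le).trans_eq ?_)
      rw [Real.mul_rpow (by positivity) hM₁0.le, ← Real.rpow_mul hα1'.le,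
        one_div_mul_cancel hp0.ne', Real.rpow_one]
    have h4 := ((mul_le_mul_left h2 _).trans h1).trans h3
    rwa [ENNReal.mul_le_mul_iff_right (ENNReal.ofReal_pos.2 hα1').ne' ENNReal.ofReal_ne_top,
      ENNReal.rpow_le_rpow_iff hp0] at h4
  have hGF : ∀ u ∈ G, ∃ v : F, eLpNorm ((u - v : Fn N) : Eu N → ℝ) (ENNReal.ofReal p) volume <
      ENNReal.ofReal ε := fun u hu => by
    obtain ⟨v, hv, huv⟩ := hnet u (hGX hu).2.2 (hGX hu).1 (hGD u hu)
    exact ⟨⟨v, hv⟩, huv.trans_lt (ENNReal.ofReal_lt_ofReal_iff hε0 |>.2 (half_lt_self hε0))⟩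
  set T : Fn N → Fn N := oddApprox (fun u : Fn N => eLpNorm u (ENNReal.ofReal p) volume)
    (ENNReal.ofReal ε) (fun v : F => (v : Fn N)) with hT
  have hTv : ∀ u, VanishesOff Ω (T u) := fun u =>
    VanishesOff.sum _ fun (v : F) _ => VanishesOff.smul (hF v v.2).1.2.2 _
  have hTs : ∀ u, holderSeminorm α (T u) ≤ ENNReal.ofReal M₂ := fun u =>
    hD.oddApprox_le _ (fun v : F => (hF v v.2).2) u
  have hTI : ∀ u, eLpNorm (T u) ∞ volume ≠ ∞ := fun u => by
    -- Only finiteness matters here, so the crude bound by the sum over the net is enough.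
    refine ne_top_of_le_ne_top ?_ (hI.oddApprox_le _
      (C := ∑ v : F, eLpNorm (v : Fn N) ∞ volume) (fun v : F => ?_) u)
    · exact ENNReal.sum_ne_top.2 fun (v : F) _ => (hF v v.2).1.1.ne
    · exact Finset.single_le_sum (f := fun v : F => eLpNorm (v : Fn N) ∞ volume)
        (fun _ _ => bot_le) (Finset.mem_univ v)
  have hTH : ∀ u, holderNorm α (T u) ≠ ∞ := fun u =>
    (max_lt (hTI u).lt_top ((hTs u).trans_lt ENNReal.ofReal_lt_top)).ne
  have hTθ : ∀ u ∈ G, ENNReal.ofReal θ ≤ eLpNorm (T u) ∞ volume := fun u hu => by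
    have h1 : eLpNorm ((T u - u : Fn N) : Eu N → ℝ) (ENNReal.ofReal p) volume ≤ ENNReal.ofReal ε :=
      hL.oddApprox_sub_le ENNReal.ofReal_ne_top (hGF u hu)
    have h2 : (1 : ℝ≥0∞) ≤ eLpNorm (T u) (ENNReal.ofReal p) volume + ENNReal.ofReal ε := by
      rw [← hG1 u hu]
      refine (hL.le_add_sub u (T u)).trans (add_le_add le_rfl ?_)
      rw [hL.sub_comm]
      exact h1
    have h3 := (hTv u).eLpNorm_le hΩ (AEEqFun.aestronglyMeasurable _) hp0
    have h4 : eLpNorm (T u) ∞ volume * volume Ω ^ (1 / p) ≤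
        ENNReal.ofReal ((eLpNorm (T u) ∞ volume).toReal * V ^ (1 / p)) := by
      rw [ENNReal.ofReal_mul ENNReal.toReal_nonneg, ENNReal.ofReal_toReal (hTI u),
        ← ENNReal.ofReal_rpow_of_pos hV0]
      gcongr
    have h5 := h2.trans (add_le_add (h3.trans h4) le_rfl)
    rw [← ENNReal.ofReal_add (by positivity) hε0.le, ENNReal.one_le_ofReal] at h5
    rw [ENNReal.ofReal_le_iff_le_toReal (hTI u)]
    have h6 : θ * V ^ (1 / p) ≤ (eLpNorm (T u) ∞ volume).toReal * V ^ (1 / p) := by linarith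
    exact le_of_mul_le_mul_right h6 (by positivity)
  have hT0 : ∀ u ∈ G, eLpNorm (T u) ∞ volume ≠ 0 := fun u hu =>
    ((ENNReal.ofReal_pos.2 hθ0).trans_le (hTθ u hu)).ne'
  set f : Fn N → Fn N := fun u => (eLpNorm (T u) ∞ volume).toReal⁻¹ • T u with hf
  have hmaps : MapsTo f G (holderSublevel Ω α M') := fun u hu => by
    refine ⟨VanishesOff.smul (hTv u) _, ?_, ?_⟩
    · exact (hI.inv_toReal_smul (hT0 u hu) (hTI u)).trans
        (ENNReal.inv_mul_cancel (hT0 u hu) (hTI u))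
    · refine (hD.inv_toReal_smul (hT0 u hu) (hTI u)).trans_le ?_
      rw [mul_comm, ← div_eq_mul_inv]
      refine ENNReal.div_le_of_le_mul ((hTs u).trans ?_)
      refine le_trans ?_ (mul_le_mul_right (hTθ u hu) _)
      rw [← ENNReal.ofReal_mul hM'0.le, hθ, mul_div_cancel₀ _ hM'0.ne']
  have hcont : @ContinuousOn _ _ (normTopology (sobolevNorm (α - N / p) p))
      (normTopology (holderNorm α)) f G := by
    let := normTopology (sobolevNorm (N := N) (α - N / p) p)
    -- Only the coefficients of `T` vary, and they are continuous already for the `L^p` norm; the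
    -- net consists of fixed vectors of finite Hölder norm. Hence `T` is continuous into the much
    -- stronger Hölder topology.
    have hTc : @ContinuousOn _ _ _ (normTopology (holderNorm α)) T G := by
      refine hH.continuousOn_sum _ fun (v : F) _ => hH.continuousOn_smul
        ((hL.continuousOn_oddCoeff ENNReal.ofReal_ne_top hGF v).mono_dom
          (normTopology_anti fun u => eLpNorm_le_sobolevNorm hp0 u))
        (@continuousOn_const _ _ _ (normTopology (holderNorm α)) _ _) fun u _ => ?_
      exact (max_lt (hF v v.2).1.1 (hF v v.2).1.2.1).ne
    have h1 : ContinuousOn (fun u : Fn N => (eLpNorm (T u) ∞ volume).toReal) G :=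
      @ContinuousOn.comp _ _ _ _ (normTopology fun u : Fn N => eLpNorm u ∞ volume)
        _ _ _ _ {u | eLpNorm u ∞ volume ≠ ∞} (hI.continuousOn_toReal fun u hu => hu)
        (hTc.mono_rng (normTopology_anti fun u => le_max_left _ _)) (fun u _ => hTI u)
    have h2 := h1.inv₀ fun u hu => (ENNReal.toReal_pos (hT0 u hu) (hTI u)).ne'
    exact hH.continuousOn_smul h2 hTc fun u _ => hTH u
  have hgenus := @genus_le_of_continuousOn _ _ (normTopology (sobolevNorm (α - N / p) p))
    (normTopology (holderNorm α)) _ _ f G _ hcont (fun u _ => by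
      simp only [hf]
      rw [show T (-u) = -T u from oddApprox_neg _ _ _ _,
        show eLpNorm ((-T u : Fn N) : Eu N → ℝ) ∞ volume = eLpNorm (T u) ∞ volume from
          hI.neg (T u), smul_neg]) hmaps
  refine (iInf₂_le _ (holderSublevel_mem_minimaxClass hΩ (hmaps.nonempty hGne)
    (hGk.trans hgenus))).trans (iSup₂_le fun v hv => ?_)
  rw [hv.2.1, div_one]
  exact hv.2.2

/-! ### Passage to the limit, including the value `∞` -/

theorem tendsto_eigenvalue (hN : 1 ≤ N) (hΩ : MeasurableSet Ω) (hΩb : Bornology.IsBounded Ω)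
    (hα0 : 0 < α) (hα1 : α < 1) (k : ℕ) :
    Tendsto (fun p : ℝ => eigenvalue Ω (α - N / p) p k ^ (1 / p)) atTop
      (𝓝 (limitEigenvalue (holderZero Ω α) α k)) := by
  refine tendsto_order.2 ⟨fun a ha => ?_, fun b hb => ?_⟩
  · obtain ⟨M, haM, hM⟩ := ENNReal.lt_iff_exists_nnreal_btwn.1 ha
    obtain ⟨M', hMM', hM'⟩ := ENNReal.lt_iff_exists_nnreal_btwn.1 hM
    have hM0 : 0 < M := ENNReal.coe_pos.1 (bot_le.trans_lt haM)
    filter_upwards [eventually_limitEigenvalue_le hN hΩ hΩb hα0 hα1 (k := k)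
      (NNReal.coe_pos.2 hM0) (NNReal.coe_lt_coe.2 (ENNReal.coe_lt_coe.1 hMM'))] with p hp
    rw [ENNReal.ofReal_coe_nnreal, ENNReal.ofReal_coe_nnreal] at hp
    exact haM.trans_le (not_lt.1 fun h => absurd (hp h) (not_le.2 hM'))
  · obtain ⟨M, hM, hMb⟩ := ENNReal.lt_iff_exists_nnreal_btwn.1 hb
    obtain ⟨M', hMM', hM'b⟩ := ENNReal.lt_iff_exists_nnreal_btwn.1 hMb
    have hM0 : 0 < M := ENNReal.coe_pos.1 (bot_le.trans_lt hM)
    filter_upwards [eventually_eigenvalue_le hΩ hΩb.measure_lt_top.ne hα0 hα1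
      (NNReal.coe_pos.2 hM0) (NNReal.coe_lt_coe.2 (ENNReal.coe_lt_coe.1 hMM'))
      (by rwa [ENNReal.ofReal_coe_nnreal])] with p hp
    rw [ENNReal.ofReal_coe_nnreal] at hp
    exact hp.trans_lt hM'b

end

end FracEigen

theorem theorem4p4 {N : ℕ} (hN : 1 ≤ N) (Ω : Set (FracEigen.Eu N)) (hΩo : IsOpen Ω)
    (hΩb : Bornology.IsBounded Ω) (α : ℝ) (hα0 : 0 < α) (hα1 : α < 1) (k : ℕ) :
    -- the limit is the minimax value over `W^{α,∞}_0(Ω)`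
    Tendsto (fun p : ℝ => FracEigen.eigenvalue Ω (α - N / p) p k ^ (1 / p)) atTop
      (𝓝 (FracEigen.limitEigenvalue (FracEigen.holderZero Ω α) α k)) ∧
    -- if `∂Ω` is not too thin (as for Lipschitz `Ω`), it is the minimax value over `C^α_0(Ω)`
    ((∀ x ∈ frontier Ω, ∀ r > 0, 0 < volume (Metric.ball x r \ Ω)) →
      Tendsto (fun p : ℝ => FracEigen.eigenvalue Ω (α - N / p) p k ^ (1 / p)) atTop
        (𝓝 (FracEigen.limitEigenvalue (FracEigen.contHolderZero Ω α) α k))) := by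
  have h := FracEigen.tendsto_eigenvalue hN hΩo.measurableSet hΩb hα0 hα1 k
  refine ⟨h, fun hfr => ?_⟩
  rwa [FracEigen.contHolderZero_eq_holderZero hΩb hα0 hα1.le hfr]
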